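/- **Theorem 4.6.** Let $X\in\mathbb R^{n\times d}$ have rows $x_1^\top,\dots,x_n^\top$, let $k\ge d$ and $\lambda>0$. Let $f$ be a real-valued function on the positive definite $d\times d$ matrices that is convex, satisfies $f(A)\ge f(B)$ whenever $A\preceq B$, and satisfies $f(tA)\le t^{-1}f(A)$ for all $t\in(0,1)$. Let $f^*$ be the minimum of $f\big(\sum_i s_ix_ix_i^\top+\lambda I\big)$ over $s\in\{0,1,\dots,k\}^n$ with $\sum_i s_i=k$. Let $w$ be the entropy or the $\ell_{1/2}$ regularizer and let $\alpha>0$ be the learning rate. Consider the following algorithm (Regularized-Regret-Min). 1. Let $\pi$ minimize $f\big(\sum_i\pi_ix_ix_i^\top+\lambda I\big)$ over real $\pi\ge0$ with $\sum_i\pi_i=k$. Set $\Sigma=\sum_i\pi_ix_ix_i^\top+\lambda I$ and $\tilde x_i=\Sigma^{-1/2}x_i$. 2. For $t=1,\dots,k$, put $L_t=\sum_{s<t}\big(\tilde x_{i_s}\tilde x_{i_s}^\top+\tfrac{\lambda}{k}\Sigma^{-1}\big)$ and do the following. - Entropy: let $A_t=\exp(-\alpha L_t-\nu_tI)$ with $\nu_t\in\mathbb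 R$ such that $\operatorname{Tr}A_t=1$, and let $B_t=\exp\big(\log A_t-\tfrac{\alpha\lambda}{k}\Sigma^{-1}\big)$. Choose $i_t\in[n]$ maximizing $\big[1-\exp(-\alpha\|\tilde x_i\|_2^2)\big]\dfrac{\tilde x_i^\top B_t\tilde x_i}{\|\tilde x_i\|_2^2}$ (read as $0$ if $\tilde x_i=0$). - $\ell_{1/2}$: let $A_t=(\alpha L_t+\nu_tI)^{-2}$ with $\nu_t\in\mathbb R$ such that $\alpha L_t+\nu_tI\succ0$ and $\operatorname{Tr}A_t=1$, and let $B_t=\big(A_t^{-1/2}+\tfrac{\alpha\lambda}{k}\Sigma^{-1}\big)^{-2}$. Choose $i_t\in[n]$ maximizing $\dfrac{\tilde x_i^\top B_t\tilde x_i}{1+\alpha\,\tilde x_i^\top B_t^{1/2}\tilde x_i}$. Points may be selected repeatedly, and ties are broken arbitrarily. Let $\epsilon\in(0,1)$ and suppose that one of the following holds: (a) $w$ is the entropy regularizer, $\alpha=4\log d/\epsilon$ and $k\ge 16\,d\log d/\epsilon^2$; (b) $w$ is the $\ell_{1/2}$ regularizer, $\alpha=8\sqrt d/\epsilon$ and $k\ge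 32\,d/\epsilon^2+16\sqrt d/\epsilon^2$. Then every possible output $S=(i_1,\dots,i_k)$ of the algorithm, with $X_S\in\mathbb R^{k\times d}$ the matrix with rows $x_{i_1}^\top,\dots,x_{i_k}^\top$, satisfies $$f\big(X_S^\top X_S+\lambda I\big)\le(1+\epsilon)\,f^*.$$ -/

import Mathlib

namespace RidgeDesign

open Matrix

/-- Assumptions on an optimality criterion `f`, imposed only on positive definite matrices:
convexity, antitonicity in the Loewner order, and reciprocal sub-linearity. -/
structure IsCriterion {d : ℕ} (f : Matrix (Fin d) (Fin d) ℝ → ℝ) : Prop where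
  convex : ∀ A B : Matrix (Fin d) (Fin d) ℝ, A.PosDef → B.PosDef →
    ∀ t : ℝ, 0 ≤ t → t ≤ 1 → f (t • A + (1 - t) • B) ≤ t * f A + (1 - t) * f B
  anti : ∀ A B : Matrix (Fin d) (Fin d) ℝ, A.PosDef → B.PosDef →
    (B - A).PosSemidef → f B ≤ f A
  sublinear : ∀ A : Matrix (Fin d) (Fin d) ℝ, A.PosDef →
    ∀ t : ℝ, 0 < t → t < 1 → f (t • A) ≤ t⁻¹ * f A

/-- The regularized covariance `∑ᵢ wᵢ xᵢ xᵢᵀ + lam I`; the rows of `X` are the points `xᵢ`. -/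
def cov {n d : ℕ} (X : Matrix (Fin n) (Fin d) ℝ) (lam : ℝ) (w : Fin n → ℝ) :
    Matrix (Fin d) (Fin d) ℝ :=
  ∑ i, w i • vecMulVec (X i) (X i) + lam • (1 : Matrix (Fin d) (Fin d) ℝ)

/-- Integer designs `s ∈ {0, …, k}ⁿ` with `‖s‖₁ = k` (selection with replacement). -/
def designs (n k : ℕ) : Set (Fin n → ℕ) :=
  {s | (∀ i, s i ≤ k) ∧ ∑ i, s i = k}

/-- The optimal value `f*` of the ridge-regularized design problem. The infimum is over a finite
set, and it is attained as soon as there is a point to select (`optValue_isLeast`). -/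
noncomputable def optValue {n d : ℕ} (f : Matrix (Fin d) (Fin d) ℝ → ℝ)
    (X : Matrix (Fin n) (Fin d) ℝ) (lam : ℝ) (k : ℕ) : ℝ :=
  sInf ((fun s : Fin n → ℕ => f (cov X lam fun i => (s i : ℝ))) '' designs n k)

theorem optValue_isLeast {n d : ℕ} (f : Matrix (Fin d) (Fin d) ℝ → ℝ)
    (X : Matrix (Fin n) (Fin d) ℝ) (lam : ℝ) (k : ℕ) (hn : 0 < n) :
    IsLeast ((fun s : Fin n → ℕ => f (cov X lam fun i => (s i : ℝ))) '' designs n k)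
      (optValue f X lam k) := by
  have hfin : (designs n k).Finite :=
    (Set.finite_Iic (fun _ : Fin n => k)).subset fun s hs i => hs.1 i
  have hne : (designs n k).Nonempty := by
    refine ⟨Pi.single ⟨0, hn⟩ k, fun i => ?_, by simp⟩
    by_cases h : i = ⟨0, hn⟩
    · subst h; simp
    · simp [Pi.single_eq_of_ne h]
  exact ⟨(hne.image _).csInf_mem (hfin.image _),
    fun a ha => csInf_le (hfin.image _).bddBelow ha⟩

/-- `w` is feasible for the continuous relaxation: `w ≥ 0` and `‖w‖₁ = k`. -/
def IsFeasibleWeight {n : ℕ} (k : ℕ) (w : Fin n → ℝ) : Prop :=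
  (∀ i, 0 ≤ w i) ∧ ∑ i, w i = k

/-- `p` is an optimal solution of the continuous relaxation. -/
def IsRelaxedSolution {n d : ℕ} (f : Matrix (Fin d) (Fin d) ℝ → ℝ)
    (X : Matrix (Fin n) (Fin d) ℝ) (lam : ℝ) (k : ℕ) (p : Fin n → ℝ) : Prop :=
  IsFeasibleWeight k p ∧
    ∀ w : Fin n → ℝ, IsFeasibleWeight k w → f (cov X lam p) ≤ f (cov X lam w)

/-- Real power of a symmetric positive definite matrix, through its eigendecomposition. -/
noncomputable def mpow {d : ℕ} (A : Matrix (Fin d) (Fin d) ℝ) (r : ℝ) :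
    Matrix (Fin d) (Fin d) ℝ :=
  cfc (fun x : ℝ => x ^ r) A

/-- Exponential of a symmetric matrix, through its eigendecomposition. -/
noncomputable def mexp {d : ℕ} (A : Matrix (Fin d) (Fin d) ℝ) : Matrix (Fin d) (Fin d) ℝ :=
  cfc Real.exp A

/-- Logarithm of a symmetric positive definite matrix, through its eigendecomposition. -/
noncomputable def mlog {d : ℕ} (A : Matrix (Fin d) (Fin d) ℝ) : Matrix (Fin d) (Fin d) ℝ :=
  cfc Real.log A

/-- The two regularizers: entropy `⟨A, log A - I⟩`, and `ℓ_{1/2}`, i.e. `-2 Tr A^{1/2}`. -/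
inductive Regularizer : Type
  | entropy
  | half

/-- The denoised point `x̃ᵢ = Σ^{-1/2} xᵢ`. -/
noncomputable def denoised {n d : ℕ} (X : Matrix (Fin n) (Fin d) ℝ)
    (Sg : Matrix (Fin d) (Fin d) ℝ) (i : Fin n) : Fin d → ℝ :=
  mpow Sg (-1 / 2) *ᵥ X i

/-- The loss matrix `x̃ᵢ x̃ᵢᵀ + (lam / k) Σ⁻¹` incurred when the point `i` is selected. -/
noncomputable def loss {n d : ℕ} (X : Matrix (Fin n) (Fin d) ℝ) (lam : ℝ) (k : ℕ)
    (Sg : Matrix (Fin d) (Fin d) ℝ) (i : Fin n) : Matrix (Fin d) (Fin d) ℝ :=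
  vecMulVec (denoised X Sg i) (denoised X Sg i) + (lam / k) • Sg⁻¹

/-- `A` is the FTRL action matrix with learning rate `α` after the cumulative loss `L`:
`exp(-α L - ν I)` (entropy) or `(α L + ν I)⁻²` with `α L + ν I` positive definite (`ℓ_{1/2}`),
where the normalization `ν` is fixed by `Tr A = 1`. For `L = 0` this is `A = I / d`. -/
def IsAction {d : ℕ} (w : Regularizer) (α : ℝ) (L A : Matrix (Fin d) (Fin d) ℝ) : Prop :=
  match w with
  | .entropy => ∃ ν : ℝ, A = mexp (-(α • L) - ν • 1) ∧ A.trace = 1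
  | .half => ∃ ν : ℝ, (α • L + ν • 1).PosDef ∧ A = mpow (α • L + ν • 1) (-2) ∧ A.trace = 1

/-- The matrix `B_t` computed from the action `A_t`: `log B = log A - (α lam / k) Σ⁻¹` (entropy),
`B^{-1/2} = A^{-1/2} + (α lam / k) Σ⁻¹` (`ℓ_{1/2}`). -/
noncomputable def shifted {d : ℕ} (w : Regularizer) (α lam : ℝ) (k : ℕ)
    (Sg A : Matrix (Fin d) (Fin d) ℝ) : Matrix (Fin d) (Fin d) ℝ :=
  match w with
  | .entropy => mexp (mlog A - (α * lam / k) • Sg⁻¹)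
  | .half => mpow (mpow A (-1 / 2) + (α * lam / k) • Sg⁻¹) (-2)

/-- The sample selection objective at a denoised point `x`. For `x = 0` the entropy objective
takes the value `0`, its limit as `x → 0`. -/
noncomputable def score {d : ℕ} (w : Regularizer) (α : ℝ) (B : Matrix (Fin d) (Fin d) ℝ)
    (x : Fin d → ℝ) : ℝ :=
  match w with
  | .entropy => (1 - Real.exp (-(α * (x ⬝ᵥ x)))) * ((x ⬝ᵥ (B *ᵥ x)) / (x ⬝ᵥ x))
  | .half => (x ⬝ᵥ (B *ᵥ x)) / (1 + α * (x ⬝ᵥ (mpow B (1 / 2) *ᵥ x)))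

/-- `idx` is a possible sequence of indices selected in the `k` rounds of the rounding stage, where
`Sg` is the regularized covariance of the relaxed solution. In round `t` the action `A t` comes from
FTRL on the losses of the previous rounds, and `idx t` maximizes the selection objective over all
`n` points (ties broken arbitrarily). -/
def IsRounding {n d : ℕ} (w : Regularizer) (X : Matrix (Fin n) (Fin d) ℝ) (lam α : ℝ) (k : ℕ)
    (Sg : Matrix (Fin d) (Fin d) ℝ) (idx : Fin k → Fin n) : Prop :=
  ∃ A : Fin k → Matrix (Fin d) (Fin d) ℝ, ∀ t : Fin k,
    IsAction w α (∑ s ∈ Finset.Iio t, loss X lam k Sg (idx s)) (A t) ∧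
    ∀ j : Fin n, score w α (shifted w α lam k Sg (A t)) (denoised X Sg j) ≤
      score w α (shifted w α lam k Sg (A t)) (denoised X Sg (idx t))

/-- `idx` is a possible output of the regularized regret-minimization algorithm: solve the
relaxation, then round. -/
def IsOutput {n d : ℕ} (w : Regularizer) (f : Matrix (Fin d) (Fin d) ℝ → ℝ)
    (X : Matrix (Fin n) (Fin d) ℝ) (lam α : ℝ) (k : ℕ) (idx : Fin k → Fin n) : Prop :=
  ∃ p : Fin n → ℝ, IsRelaxedSolution f X lam k p ∧
    IsRounding w X lam α k (cov X lam p) idx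

end RidgeDesign

/-! Put C = (lam/k) Σ⁻¹. Whitening by Σ^{-1/2} turns the relaxed solution into the identity ∑ pᵢ
x̃ᵢx̃ᵢᵀ = I - kC, and the cumulative loss into Σ^{-1/2} (X_SᵀX_S + lam I) Σ^{-1/2}. It is enough
that this loss dominates (1+ε)⁻¹ I: antitonicity and sublinearity then bound the criterion by (1+ε)
f(Σ), and f(Σ) ≤ f* because integer designs are feasible for the relaxation
(`criterion_le_of_sum_loss_posSemidef`).

The spectral bound comes from a potential that controls the least eigenvalue of the loss L: Tr
exp(-αL) for entropy, and the minimum over ν of Tr (αL + νI)⁻¹ + ν for ℓ_{1/2}. A round is split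
into the ridge update αC, which gains at least α Tr(BC), and the rank-one update, which gains a
multiple of the score. Averaging the selection rule over p bounds the best score from below, up to a
deficit proportional to k Tr(BC); the ridge gain pays for this deficit (`trace_mexp_step_le`,
`trace_inv_step_le`).

For entropy the increments do not commute with the exponent, so Golden–Thompson and Klein replace
scalar calculus; for ℓ_{1/2}, Sherman–Morrison and the convexity of Tr Y⁻¹ suffice. Iterating over k
rounds (`sum_loss_entropy`, `sum_loss_half`) leaves scalar estimates (`entropy_rate_bound`,
`half_rate_bound`). -/

namespace RidgeDesign

open Matrix

/-! ### Golden–Thompson, from dyadic trace inequalities and the Lie–Trotter formula -/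

section GoldenThompson

variable {n : Type*} [Fintype n]

/-- Cauchy–Schwarz for the trace form. -/
theorem two_mul_trace_mul_le (P Q : Matrix n n ℝ) :
    2 * (P * Q).trace ≤ (P * Pᵀ).trace + (Qᵀ * Q).trace := by
  have h := (posSemidef_self_mul_conjTranspose (P - Qᵀ)).trace_nonneg
  have e : (Qᵀ * Pᵀ).trace = (P * Q).trace := by
    rw [← transpose_mul, trace_transpose]
  simp only [conjTranspose_eq_transpose_of_trivial, transpose_sub, transpose_transpose,
    sub_mul, mul_sub, trace_sub, e] at h
  linarith

variable [DecidableEq n]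

theorem trace_mul_pow_comm (P Q : Matrix n n ℝ) (m : ℕ) :
    ((P * Q) ^ m).trace = ((Q * P) ^ m).trace := by
  cases m with
  | zero => simp
  | succ m =>
    rw [pow_succ, ← mul_assoc, mul_pow_mul, mul_assoc, trace_mul_comm, mul_assoc, ← pow_succ]

/-- The two dyadic trace inequalities behind the Golden–Thompson inequality, proved together. -/
theorem trace_dyadic_pow_le (j : ℕ) :
    (∀ M : Matrix n n ℝ, (M ^ 2 ^ (j + 1)).trace ≤ ((M * Mᵀ) ^ 2 ^ j).trace) ∧
    (∀ P Q : Matrix n n ℝ, Pᵀ = P → Qᵀ = Q →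
      ((P * Q) ^ 2 ^ j).trace ≤ (P ^ 2 ^ j * Q ^ 2 ^ j).trace) := by
  induction j with
  | zero =>
    refine ⟨fun M => ?_, fun P Q _ _ => by simp⟩
    have h := two_mul_trace_mul_le M M
    rw [trace_mul_comm Mᵀ M] at h
    simp only [zero_add, pow_one, pow_zero, pow_two]
    linarith
  | succ j ih =>
    obtain ⟨ha, hb⟩ := ih
    constructor
    -- By cyclicity M²(M²)ᵀ may be replaced by the product of the symmetric matrices MᵀM and MMᵀ.
    -- The second inequality separates their powers, and Cauchy–Schwarz recombines them, since both
    -- have the same trace of powers.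
    · intro M
      have h1 := ha (M ^ 2)
      have h2 := hb (Mᵀ * M) (M * Mᵀ) (by simp) (by simp)
      have h3 := two_mul_trace_mul_le ((Mᵀ * M) ^ 2 ^ j) ((M * Mᵀ) ^ 2 ^ j)
      have e1 : ((M ^ 2 * (M ^ 2)ᵀ) ^ 2 ^ j).trace = ((Mᵀ * M * (M * Mᵀ)) ^ 2 ^ j).trace := by
        rw [pow_two, transpose_mul, ← mul_assoc, trace_mul_pow_comm]
        simp only [mul_assoc]
      have e2 : ((Mᵀ * M) ^ 2 ^ j * ((Mᵀ * M) ^ 2 ^ j)ᵀ).trace = ((M * Mᵀ) ^ 2 ^ (j + 1)).trace := by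
        rw [transpose_pow, transpose_mul, transpose_transpose, ← pow_add, trace_mul_pow_comm,
          pow_succ 2 j, mul_two]
      have e3 : (((M * Mᵀ) ^ 2 ^ j)ᵀ * (M * Mᵀ) ^ 2 ^ j).trace = ((M * Mᵀ) ^ 2 ^ (j + 1)).trace := by
        rw [transpose_pow, transpose_mul, transpose_transpose, ← pow_add, pow_succ 2 j, mul_two]
      rw [← pow_mul, ← pow_succ'] at h1
      linarith
    -- The first inequality at P * Q, followed by cyclicity, reduces the claim to P² and Q² at the
    -- previous exponent.
    · intro P Q hP hQ
      have h1 := ha (P * Q)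
      have h2 := hb (P ^ 2) (Q ^ 2) (by rw [transpose_pow, hP]) (by rw [transpose_pow, hQ])
      have e1 : ((P * Q * (P * Q)ᵀ) ^ 2 ^ j).trace = ((P ^ 2 * Q ^ 2) ^ 2 ^ j).trace := by
        rw [transpose_mul, hP, hQ, mul_assoc, trace_mul_pow_comm]
        rw [trace_mul_pow_comm (P ^ 2)]
        simp only [mul_assoc, pow_two]
      rw [← pow_mul, ← pow_mul, ← pow_succ'] at h2
      linarith

theorem norm_exp_le_exp_norm {𝔸 : Type*} [NormedRing 𝔸] [NormOneClass 𝔸] [NormedAlgebra ℝ 𝔸]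
    [CompleteSpace 𝔸] (x : 𝔸) : ‖NormedSpace.exp x‖ ≤ Real.exp ‖x‖ := by
  have h1 := NormedSpace.exp_series_hasSum_exp' (𝕂 := ℝ) x
  have h2 := NormedSpace.exp_series_hasSum_exp' (𝕂 := ℝ) ‖x‖
  rw [← Real.exp_eq_exp_ℝ] at h2
  rw [← h1.tsum_eq]
  refine tsum_of_norm_bounded h2 fun i => ?_
  rw [norm_smul, smul_eq_mul, Real.norm_of_nonneg (by positivity)]
  gcongr
  exact norm_pow_le x i

/-- Telescoping. The exponent m in place of m - 1 costs a factor c ≥ 1 and avoids a truncated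
subtraction. -/
theorem norm_pow_sub_pow_le {𝔸 : Type*} [NormedRing 𝔸] [NormOneClass 𝔸] (S T : 𝔸) (c : ℝ)
    (hc : 1 ≤ c) (hS : ‖S‖ ≤ c) (hT : ‖T‖ ≤ c) (m : ℕ) :
    ‖S ^ m - T ^ m‖ ≤ m * c ^ m * ‖S - T‖ := by
  induction m with
  | zero => simp
  | succ m ih =>
    have e : S ^ (m + 1) - T ^ (m + 1) = S * (S ^ m - T ^ m) + (S - T) * T ^ m := by
      rw [pow_succ', pow_succ']; noncomm_ring
    have hTm : ‖T ^ m‖ ≤ c ^ (m + 1) :=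
      ((norm_pow_le T m).trans (by gcongr)).trans (pow_le_pow_right₀ hc m.le_succ)
    calc ‖S ^ (m + 1) - T ^ (m + 1)‖
        ≤ ‖S‖ * ‖S ^ m - T ^ m‖ + ‖S - T‖ * ‖T ^ m‖ := by
          rw [e]
          exact (norm_add_le _ _).trans (add_le_add (norm_mul_le _ _) (norm_mul_le _ _))
      _ ≤ c * (m * c ^ m * ‖S - T‖) + ‖S - T‖ * c ^ (m + 1) := by gcongr
      _ = ((m + 1 : ℕ) : ℝ) * c ^ (m + 1) * ‖S - T‖ := by push_cast; ring

open Filter Topology in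
/-- The Lie–Trotter product formula, along powers of two. -/
theorem tendsto_lie_trotter {𝔸 : Type*} [NormedRing 𝔸] [NormOneClass 𝔸] [NormedAlgebra ℝ 𝔸]
    [CompleteSpace 𝔸] (H K : 𝔸) :
    Tendsto (fun m : ℕ => (NormedSpace.exp (((2 : ℝ) ^ m)⁻¹ • H) *
      NormedSpace.exp (((2 : ℝ) ^ m)⁻¹ • K)) ^ 2 ^ m) atTop (𝓝 (NormedSpace.exp (H + K))) := by
  let _ : NormedAlgebra ℚ 𝔸 := NormedAlgebra.restrictScalars ℚ ℝ 𝔸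
  have hd (G : 𝔸) : HasDerivAt (fun t : ℝ => NormedSpace.exp (t • G)) G 0 := by
    simpa using hasDerivAt_exp_smul_const (𝕂 := ℝ) G 0
  -- The two curves agree to first order at 0, so their difference is o(t); this beats the factor
  -- 2^m = t⁻¹ produced by taking powers.
  have hf : HasDerivAt (fun t : ℝ => NormedSpace.exp (t • H) * NormedSpace.exp (t • K) -
      NormedSpace.exp (t • (H + K))) 0 0 := by
    have h := ((hd H).mul (hd K)).sub (hd (H + K))
    simp only [zero_smul, NormedSpace.exp_zero, mul_one, one_mul, sub_self] at h
    exact h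
  have hu : Tendsto (fun m : ℕ => ((2 : ℝ) ^ m)⁻¹) atTop (𝓝[≠] 0) := by
    refine tendsto_nhdsWithin_iff.2 ⟨?_, Eventually.of_forall fun m => ?_⟩
    · simpa using tendsto_pow_atTop_nhds_zero_of_lt_one (r := (2 : ℝ)⁻¹) (by norm_num) (by norm_num)
    · simp
  have hs := (hasDerivAt_iff_tendsto_slope.1 hf).comp hu
  have hs' := (hs.norm).const_mul (Real.exp (‖H‖ + ‖K‖))
  rw [norm_zero, mul_zero] at hs'
  rw [tendsto_iff_norm_sub_tendsto_zero]
  refine squeeze_zero (fun _ => norm_nonneg _) (fun m => ?_) hs'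
  have h2 : (0 : ℝ) < 2 ^ m := by positivity
  set t : ℝ := ((2 : ℝ) ^ m)⁻¹ with ht
  have ht0 : 0 < t := inv_pos.2 h2
  have hmt : ((2 ^ m : ℕ) : ℝ) = t⁻¹ := by simp [ht]
  have e : NormedSpace.exp (H + K) = NormedSpace.exp (t • (H + K)) ^ 2 ^ m := by
    rw [← NormedSpace.exp_nsmul, ← Nat.cast_smul_eq_nsmul ℝ, hmt, smul_smul,
      inv_mul_cancel₀ ht0.ne', one_smul]
  have hb (G : 𝔸) : ‖NormedSpace.exp (t • G)‖ ≤ Real.exp (t * ‖G‖) := by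
    refine (norm_exp_le_exp_norm _).trans (Real.exp_le_exp.2 ?_)
    rw [norm_smul, Real.norm_of_nonneg ht0.le]
  have hT : ‖NormedSpace.exp (t • H) * NormedSpace.exp (t • K)‖ ≤ Real.exp (t * (‖H‖ + ‖K‖)) := by
    refine (norm_mul_le _ _).trans ?_
    rw [mul_add, Real.exp_add]
    exact mul_le_mul (hb H) (hb K) (norm_nonneg _) (Real.exp_pos _).le
  have hS : ‖NormedSpace.exp (t • (H + K))‖ ≤ Real.exp (t * (‖H‖ + ‖K‖)) := by
    refine (hb _).trans (Real.exp_le_exp.2 ?_)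
    gcongr
    exact norm_add_le _ _
  rw [e]
  refine (norm_pow_sub_pow_le _ _ _ (Real.one_le_exp (by positivity)) hT hS _).trans_eq ?_
  rw [← Real.exp_nat_mul, hmt, inv_mul_cancel_left₀ ht0.ne']
  simp only [Function.comp_apply, slope_def_module, ← ht, sub_zero, norm_smul, zero_smul,
    NormedSpace.exp_zero, mul_one, sub_self, norm_inv, Real.norm_of_nonneg ht0.le]
  ring

open scoped Matrix.Norms.L2Operator

/-- The Golden–Thompson inequality. -/
theorem trace_exp_add_le (H K : Matrix n n ℝ) (hH : H.IsHermitian) (hK : K.IsHermitian) :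
    (NormedSpace.exp (H + K)).trace ≤ (NormedSpace.exp H * NormedSpace.exp K).trace := by
  cases isEmpty_or_nonempty n with
  | inl _ => simp [Matrix.trace]
  | inr _ =>
    have hlim := tendsto_lie_trotter H K
    have hc : Continuous (fun M : Matrix n n ℝ => M.trace) := by fun_prop
    refine le_of_tendsto ((hc.tendsto _).comp hlim) (Filter.Eventually.of_forall fun m => ?_)
    have hsymm (G : Matrix n n ℝ) (hG : G.IsHermitian) :
        (NormedSpace.exp (((2 : ℝ) ^ m)⁻¹ • G))ᵀ = NormedSpace.exp (((2 : ℝ) ^ m)⁻¹ • G) := by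
      rw [← exp_transpose, transpose_smul, ← conjTranspose_eq_transpose_of_trivial, hG]
    have hpow (G : Matrix n n ℝ) :
        NormedSpace.exp (((2 : ℝ) ^ m)⁻¹ • G) ^ 2 ^ m = NormedSpace.exp G := by
      rw [← Matrix.exp_nsmul, ← Nat.cast_smul_eq_nsmul ℝ, smul_smul]
      simp
    have h := (trace_dyadic_pow_le m).2 _ _ (hsymm H hH) (hsymm K hK)
    rwa [hpow, hpow] at h

end GoldenThompson

/-! ### Matrix exponentials, logarithms and real powers by functional calculus -/

section FunctionalCalculus

variable {d : ℕ}

open scoped MatrixOrder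

open scoped Matrix.Norms.L2Operator in
theorem mexp_eq_exp {H : Matrix (Fin d) (Fin d) ℝ} (hH : H.IsHermitian) :
    mexp H = NormedSpace.exp H :=
  CFC.real_exp_eq_normedSpace_exp (a := H) (ha := hH)

theorem mlog_mexp {H : Matrix (Fin d) (Fin d) ℝ} (hH : H.IsHermitian) : mlog (mexp H) = H := by
  have hsa : IsSelfAdjoint H := hH
  unfold mlog mexp
  rw [← cfc_comp' Real.log Real.exp H (Real.continuousOn_log.mono (by
    rintro _ ⟨x, _, rfl⟩; exact (Real.exp_pos x).ne')) (by fun_prop)]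
  simp [cfc_id' ℝ H]

theorem posSemidef_mexp (H : Matrix (Fin d) (Fin d) ℝ) : (mexp H).PosSemidef :=
  nonneg_iff_posSemidef.1 (cfc_nonneg fun x _ => (Real.exp_pos x).le)

theorem cfc_affine {H : Matrix (Fin d) (Fin d) ℝ} (hH : H.IsHermitian) (a b : ℝ) :
    cfc (fun x : ℝ => a + b * x) H = a • (1 : Matrix (Fin d) (Fin d) ℝ) + b • H := by
  have hsa : IsSelfAdjoint H := hH
  rw [cfc_const_add a (fun x => b * x) H, cfc_const_mul_id b H, Algebra.algebraMap_eq_smul_one]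

/-- The tangent line inequality for the matrix exponential. -/
theorem mexp_sub_tangent_posSemidef {H : Matrix (Fin d) (Fin d) ℝ} (hH : H.IsHermitian) (c : ℝ) :
    (mexp H - Real.exp c • ((1 - c) • (1 : Matrix (Fin d) (Fin d) ℝ) + H)).PosSemidef := by
  have hsa : IsSelfAdjoint H := hH
  rw [← le_iff, smul_add, smul_smul, ← cfc_affine hH]
  refine cfc_mono (fun x _ => ?_) (by fun_prop) (by fun_prop)
  have h := Real.add_one_le_exp (x - c)
  have e : Real.exp x = Real.exp c * Real.exp (x - c) := by rw [← Real.exp_add]; ring_nf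
  rw [e]
  nlinarith [Real.exp_pos c]

theorem spectrum_subset_Icc {G : Matrix (Fin d) (Fin d) ℝ} {r : ℝ} (hG : G.PosSemidef)
    (hGr : (r • (1 : Matrix (Fin d) (Fin d) ℝ) - G).PosSemidef) :
    ∀ s ∈ spectrum ℝ G, 0 ≤ s ∧ s ≤ r := by
  have hsa : IsSelfAdjoint G := hG.isHermitian
  intro s hs
  refine ⟨spectrum_nonneg_of_nonneg hG.nonneg hs, ?_⟩
  rw [← le_iff] at hGr
  have h : cfc (fun x : ℝ => x) G ≤ cfc (fun _ : ℝ => r) G := by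
    rw [cfc_id' ℝ G, cfc_const r G, Algebra.algebraMap_eq_smul_one]
    exact hGr
  exact (cfc_le_iff _ _ G).1 h s hs

/-- The chord inequality for the matrix exponential. -/
theorem chord_sub_exp_posSemidef {G : Matrix (Fin d) (Fin d) ℝ} {r : ℝ} (β : ℝ) (hr : 0 < r)
    (hG : G.PosSemidef) (hGr : (r • (1 : Matrix (Fin d) (Fin d) ℝ) - G).PosSemidef) :
    (1 + ((Real.exp (β * r) - 1) / r) • G - NormedSpace.exp (β • G)).PosSemidef := by
  have hH : G.IsHermitian := hG.isHermitian
  have hsa : IsSelfAdjoint G := hH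
  have hβ : (β • G).IsHermitian := hH.smul (by simp [IsSelfAdjoint])
  rw [← mexp_eq_exp hβ, ← le_iff]
  have e := cfc_affine hH 1 ((Real.exp (β * r) - 1) / r)
  rw [one_smul] at e
  have e2 : mexp (β • G) = cfc (fun x : ℝ => Real.exp (β * x)) G := by
    unfold mexp
    rw [← cfc_comp_const_mul β Real.exp G]
  rw [← e, e2]
  refine cfc_mono (fun x hx => ?_) (by fun_prop) (by fun_prop)
  obtain ⟨h0, h1⟩ := spectrum_subset_Icc hG hGr x hx
  have hconv := convexOn_exp.2 (Set.mem_univ 0) (Set.mem_univ (β * r))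
    (show 0 ≤ 1 - x / r by rw [sub_nonneg, div_le_one hr]; exact h1)
    (show 0 ≤ x / r by positivity) (by ring)
  simp only [smul_eq_mul, mul_zero, zero_add, Real.exp_zero, mul_one] at hconv
  have e3 : x / r * (β * r) = β * x := by field_simp
  rw [e3] at hconv
  refine hconv.trans_eq ?_
  field_simp
  ring

theorem spectrum_pos_of_posDef {Y : Matrix (Fin d) (Fin d) ℝ} (hY : Y.PosDef) :
    ∀ s ∈ spectrum ℝ Y, 0 < s := fun _ hs =>
  (isStrictlyPositive_iff_posDef.2 hY).spectrum_pos hs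

theorem isHermitian_mpow (Y : Matrix (Fin d) (Fin d) ℝ) (r : ℝ) : (mpow Y r).IsHermitian :=
  cfc_predicate _ Y

theorem continuousOn_rpow_spectrum {Y : Matrix (Fin d) (Fin d) ℝ} (hY : Y.PosDef) (r : ℝ) :
    ContinuousOn (fun x : ℝ => x ^ r) (spectrum ℝ Y) := fun s hs =>
  (Real.continuousAt_rpow_const s r (Or.inl (spectrum_pos_of_posDef hY s hs).ne')).continuousWithinAt

theorem mpow_add {Y : Matrix (Fin d) (Fin d) ℝ} (hY : Y.PosDef) (a b : ℝ) :
    mpow Y (a + b) = mpow Y a * mpow Y b := by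
  unfold mpow
  rw [← cfc_mul _ _ Y (continuousOn_rpow_spectrum hY a) (continuousOn_rpow_spectrum hY b)]
  exact cfc_congr fun s hs => Real.rpow_add (spectrum_pos_of_posDef hY s hs) a b

theorem mpow_zero {Y : Matrix (Fin d) (Fin d) ℝ} (hY : Y.PosDef) : mpow Y 0 = 1 := by
  have hsa : IsSelfAdjoint Y := hY.isHermitian
  unfold mpow
  simp [cfc_const_one ℝ Y]

theorem mpow_one {Y : Matrix (Fin d) (Fin d) ℝ} (hY : Y.PosDef) : mpow Y 1 = Y := by
  have hsa : IsSelfAdjoint Y := hY.isHermitian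
  unfold mpow
  simp [cfc_id' ℝ Y]

theorem mpow_neg_one {Y : Matrix (Fin d) (Fin d) ℝ} (hY : Y.PosDef) : mpow Y (-1) = Y⁻¹ := by
  refine (inv_eq_left_inv ?_).symm
  nth_rewrite 2 [← mpow_one hY]
  rw [← mpow_add hY]
  norm_num [mpow_zero hY]

theorem mpow_neg_two {Y : Matrix (Fin d) (Fin d) ℝ} (hY : Y.PosDef) :
    mpow Y (-2) = Y⁻¹ * Y⁻¹ := by
  rw [← mpow_neg_one hY, ← mpow_add hY]
  norm_num

theorem mpow_mpow {Y : Matrix (Fin d) (Fin d) ℝ} (hY : Y.PosDef) (a b : ℝ) :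
    mpow (mpow Y a) b = mpow Y (a * b) := by
  have hsa : IsSelfAdjoint Y := hY.isHermitian
  unfold mpow
  rw [← cfc_comp' (fun x : ℝ => x ^ b) (fun x : ℝ => x ^ a) Y (fun s hs => ?_)
    (continuousOn_rpow_spectrum hY a)]
  · exact cfc_congr fun s hs => (Real.rpow_mul (spectrum_pos_of_posDef hY s hs).le a b).symm
  · obtain ⟨x, hx, rfl⟩ := hs
    exact (Real.continuousAt_rpow_const _ b (Or.inl
      (Real.rpow_pos_of_pos (spectrum_pos_of_posDef hY x hx) a).ne')).continuousWithinAt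

end FunctionalCalculus

/-! ### Trace inequalities: Klein, Golden–Thompson with a chord, convexity of the inverse -/

section TraceInequalities

variable {d : ℕ}

open scoped MatrixOrder Matrix.Norms.L2Operator

theorem exists_diagonalization {H : Matrix (Fin d) (Fin d) ℝ} (hH : H.IsHermitian) :
    ∃ (U : Matrix (Fin d) (Fin d) ℝ) (h : Fin d → ℝ), Uᵀ * U = 1 ∧ U * Uᵀ = 1 ∧
      ∀ f : ℝ → ℝ, cfc f H = U * diagonal (fun i => f (h i)) * Uᵀ := by
  refine ⟨hH.eigenvectorUnitary, hH.eigenvalues, ?_, ?_, fun f => ?_⟩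
  · exact Unitary.coe_star_mul_self hH.eigenvectorUnitary
  · exact Unitary.coe_mul_star_self hH.eigenvectorUnitary
  · rw [hH.cfc_eq, IsHermitian.cfc, Unitary.conjStarAlgAut_apply]
    rfl

theorem trace_mul_nonneg {P Q : Matrix (Fin d) (Fin d) ℝ} (hP : P.PosSemidef)
    (hQ : Q.PosSemidef) : 0 ≤ (P * Q).trace := by
  obtain ⟨M, rfl⟩ := CStarAlgebra.nonneg_iff_eq_star_mul_self.1 hP.nonneg
  rw [mul_assoc, trace_mul_comm, star_eq_conjTranspose]
  exact (hQ.mul_mul_conjTranspose_same M).trace_nonneg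

/-- Each eigenvalue is one of the nonnegative terms whose sum is the trace. -/
theorem trace_smul_one_sub_posSemidef {P : Matrix (Fin d) (Fin d) ℝ} (hP : P.PosSemidef) :
    (P.trace • (1 : Matrix (Fin d) (Fin d) ℝ) - P).PosSemidef := by
  have hsa : IsSelfAdjoint P := hP.isHermitian
  obtain ⟨U, h, hU, hU', hf⟩ := exists_diagonalization hP.isHermitian
  have hPd : P = U * diagonal h * Uᵀ := by
    have := hf id
    rwa [cfc_id ℝ P] at this
  have hdiag : diagonal h = Uᵀ * P * U := by
    rw [hPd]
    simp only [mul_assoc, hU, mul_one]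
    rw [← mul_assoc, hU, one_mul]
  have hpos (i : Fin d) : 0 ≤ h i := by
    have := hP.conjTranspose_mul_mul_same U
    rw [conjTranspose_eq_transpose_of_trivial, ← hdiag] at this
    simpa using this.diag_nonneg (i := i)
  have htr : P.trace = ∑ i, h i := by
    rw [hPd, mul_assoc, trace_mul_comm, mul_assoc, hU, mul_one, trace_diagonal]
  have e : P.trace • (1 : Matrix (Fin d) (Fin d) ℝ) - P =
      U * diagonal (fun i => P.trace - h i) * Uᴴ := by
    have : diagonal (fun i => P.trace - h i) =
        P.trace • (1 : Matrix (Fin d) (Fin d) ℝ) - diagonal h := by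
      rw [smul_one_eq_diagonal, diagonal_sub]
    rw [this, mul_sub, sub_mul, conjTranspose_eq_transpose_of_trivial, ← hPd]
    simp [hU']
  rw [e]
  refine (PosSemidef.diagonal fun i => ?_).mul_mul_conjTranspose_same U
  rw [Pi.zero_apply, sub_nonneg, htr]
  exact Finset.single_le_sum (fun j _ => hpos j) (Finset.mem_univ i)

theorem trace_mul_le_trace_mul_trace {P Q : Matrix (Fin d) (Fin d) ℝ} (hP : P.PosSemidef)
    (hQ : Q.PosSemidef) : (P * Q).trace ≤ P.trace * Q.trace := by
  have h := trace_mul_nonneg (trace_smul_one_sub_posSemidef hP) hQ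
  rw [sub_mul, smul_mul_assoc, one_mul, trace_sub, trace_smul, smul_eq_mul] at h
  linarith

/-- Klein's inequality for the exponential. -/
theorem trace_mexp_add_le {G H : Matrix (Fin d) (Fin d) ℝ} (hG : G.IsHermitian)
    (hH : H.IsHermitian) :
    (mexp H).trace + ((G - H) * mexp H).trace ≤ (mexp G).trace := by
  have hsa : IsSelfAdjoint H := hH
  obtain ⟨U, h, hU, hU', hf⟩ := exists_diagonalization hH
  -- The tangent line for exp G is taken at the i-th eigenvalue of H and tested on the matching
  -- eigenvector; summing over i gives Klein.
  have hdiag (i : Fin d) : Real.exp (h i) * ((1 - h i) + (Uᵀ * G * U) i i) ≤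
      (Uᵀ * mexp G * U) i i := by
    have := ((mexp_sub_tangent_posSemidef hG (h i)).conjTranspose_mul_mul_same U).diag_nonneg
      (i := i)
    simp only [conjTranspose_eq_transpose_of_trivial, mul_sub, sub_mul, mul_smul_comm,
      smul_mul_assoc, mul_add, add_mul, mul_one, hU, Matrix.sub_apply, Matrix.smul_apply, Matrix.add_apply, one_apply_eq,
      smul_eq_mul] at this
    linarith
  have hsum := Finset.sum_le_sum fun i (_ : i ∈ Finset.univ) => hdiag i
  have e1 : ∑ i, (Uᵀ * mexp G * U) i i = (mexp G).trace := by
    change (Uᵀ * mexp G * U).trace = _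
    rw [mul_assoc, trace_mul_comm, mul_assoc, hU', mul_one]
  have e2 : (mexp H).trace = ∑ i, Real.exp (h i) := by
    rw [mexp, hf, mul_assoc, trace_mul_comm, mul_assoc, hU, mul_one, trace_diagonal]
  have e3 (M : Matrix (Fin d) (Fin d) ℝ) :
      (M * mexp H).trace = ∑ i, Real.exp (h i) * (Uᵀ * M * U) i i := by
    rw [mexp, hf, ← mul_assoc, trace_mul_comm, ← mul_assoc, ← mul_assoc, Matrix.trace]
    simp only [diag_apply, mul_diagonal, mul_comm]
  have e4 (i : Fin d) : (Uᵀ * H * U) i i = h i := by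
    have hHd : H = U * diagonal h * Uᵀ := by
      have := hf id
      rwa [cfc_id ℝ H] at this
    have : Uᵀ * H * U = diagonal h := by
      rw [hHd]
      simp only [mul_assoc, hU, mul_one]
      rw [← mul_assoc, hU, one_mul]
    rw [this, diagonal_apply_eq]
  rw [sub_mul, trace_sub, e3 G, e3 H, e2, ← e1]
  simp only [e4]
  refine le_trans (le_of_eq ?_) hsum
  rw [← Finset.sum_sub_distrib, ← Finset.sum_add_distrib]
  exact Finset.sum_congr rfl fun i _ => by ring

/-- Golden–Thompson for the functional-calculus exponential. -/
theorem trace_mexp_add_le_trace_mul {H K : Matrix (Fin d) (Fin d) ℝ} (hH : H.IsHermitian)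
    (hK : K.IsHermitian) :
    (mexp (H + K)).trace ≤ (mexp H * NormedSpace.exp K).trace := by
  rw [mexp_eq_exp (hH.add hK), mexp_eq_exp hH]
  exact trace_exp_add_le H K hH hK

/-- Golden–Thompson combined with the chord bound on the second exponential. -/
theorem trace_mexp_add_smul_le {H G : Matrix (Fin d) (Fin d) ℝ} {r : ℝ} (β : ℝ) (hr : 0 < r)
    (hH : H.IsHermitian) (hG : G.PosSemidef)
    (hGr : (r • (1 : Matrix (Fin d) (Fin d) ℝ) - G).PosSemidef) :
    (mexp (H + β • G)).trace ≤
      (mexp H).trace + (Real.exp (β * r) - 1) / r * (mexp H * G).trace := by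
  have h1 := trace_mexp_add_le_trace_mul hH (hG.isHermitian.smul (k := β) (by simp [IsSelfAdjoint]))
  have h2 := trace_mul_nonneg (posSemidef_mexp H) (chord_sub_exp_posSemidef β hr hG hGr)
  rw [mul_sub, mul_add, mul_one, mul_smul_comm, trace_sub, trace_add, trace_smul,
    smul_eq_mul] at h2
  linarith

theorem vecMulVec_posSemidef (y : Fin d → ℝ) : (vecMulVec y y).PosSemidef := by
  simpa using posSemidef_vecMulVec_self_star y

theorem trace_mul_vecMulVec (M : Matrix (Fin d) (Fin d) ℝ) (y : Fin d → ℝ) :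
    (M * vecMulVec y y).trace = y ⬝ᵥ (M *ᵥ y) := by
  rw [mul_vecMulVec, trace_vecMulVec, dotProduct_comm]

theorem smul_one_sub_vecMulVec_posSemidef (y : Fin d → ℝ) :
    ((y ⬝ᵥ y) • (1 : Matrix (Fin d) (Fin d) ℝ) - vecMulVec y y).PosSemidef := by
  have h := trace_smul_one_sub_posSemidef (vecMulVec_posSemidef y)
  rwa [trace_vecMulVec] at h

theorem dotProduct_mulVec_nonneg {M : Matrix (Fin d) (Fin d) ℝ} (hM : M.PosSemidef)
    (y : Fin d → ℝ) : 0 ≤ y ⬝ᵥ (M *ᵥ y) := by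
  rw [← trace_mul_vecMulVec]
  exact trace_mul_nonneg hM (vecMulVec_posSemidef y)

theorem posSemidef_of_dotProduct_nonneg {M : Matrix (Fin d) (Fin d) ℝ} (hM : M.IsHermitian)
    (h : ∀ y : Fin d → ℝ, 0 ≤ y ⬝ᵥ (M *ᵥ y)) : M.PosSemidef :=
  .of_dotProduct_mulVec_nonneg hM fun y => by simpa using h y

/-- The tangent inequality for the matrix inverse. -/
theorem inv_sub_tangent_posSemidef {Z X : Matrix (Fin d) (Fin d) ℝ} (hZ : Z.PosDef)
    (hX : X.IsHermitian) : (Z⁻¹ - ((2 : ℝ) • X - X * Z * X)).PosSemidef := by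
  have hu := (isUnit_iff_isUnit_det _).1 hZ.isUnit
  have h := hZ.posSemidef.mul_mul_conjTranspose_same (Z⁻¹ - X)
  have e : (Z⁻¹ - X)ᴴ = Z⁻¹ - X := hZ.inv.isHermitian.sub hX
  rw [e] at h
  have e2 : (Z⁻¹ - X) * Z * (Z⁻¹ - X) = Z⁻¹ - ((2 : ℝ) • X - X * Z * X) := by
    have h1 : X * Z * Z⁻¹ = X := by rw [mul_assoc, mul_nonsing_inv _ hu, mul_one]
    rw [sub_mul, nonsing_inv_mul _ hu, sub_mul, mul_sub (X * Z), one_mul, h1, two_smul]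
    abel
  rwa [e2] at h

/-- Convexity of `Y ↦ Tr Y⁻¹`, in tangent form. -/
theorem trace_inv_add_le {Y Z : Matrix (Fin d) (Fin d) ℝ} (hY : Y.PosDef) (hZ : Z.PosDef) :
    2 * (Z⁻¹).trace ≤ (Y⁻¹).trace + (Z⁻¹ * Z⁻¹ * Y).trace := by
  have h := (inv_sub_tangent_posSemidef hY hZ.inv.isHermitian).trace_nonneg
  rw [trace_sub, trace_sub, trace_smul, smul_eq_mul, mul_assoc, trace_mul_comm, mul_assoc,
    trace_mul_comm Y] at h
  linarith

end TraceInequalities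

/-! ### One round of selection: progress of the potential -/

section Steps

variable {n d : ℕ}

theorem one_div_smul_one_sub_posSemidef {κ : ℝ} (hκ : 0 < κ) {C : Matrix (Fin d) (Fin d) ℝ}
    {y : Fin n → Fin d → ℝ} {p : Fin n → ℝ} (hp : ∀ i, 0 ≤ p i)
    (hy : ∑ i, p i • vecMulVec (y i) (y i) = 1 - κ • C) :
    (κ⁻¹ • (1 : Matrix (Fin d) (Fin d) ℝ) - C).PosSemidef := by
  have h : (∑ i, p i • vecMulVec (y i) (y i)).PosSemidef :=
    posSemidef_sum _ fun i _ => (vecMulVec_posSemidef (y i)).smul (hp i)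
  rw [hy] at h
  have h2 := h.smul (inv_pos.2 hκ).le
  rwa [smul_sub, smul_smul, inv_mul_cancel₀ hκ.ne', one_smul] at h2

theorem sum_mul_dotProduct_mulVec {κ : ℝ} {C : Matrix (Fin d) (Fin d) ℝ}
    {y : Fin n → Fin d → ℝ} {p : Fin n → ℝ}
    (hy : ∑ i, p i • vecMulVec (y i) (y i) = 1 - κ • C) (M : Matrix (Fin d) (Fin d) ℝ) :
    ∑ i, p i * (y i ⬝ᵥ (M *ᵥ y i)) = M.trace - κ * (M * C).trace := by
  have h := congrArg (fun N => (M * N).trace) hy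
  simp only [Finset.mul_sum, trace_sum, mul_smul_comm, trace_smul, trace_mul_vecMulVec,
    smul_eq_mul, mul_sub, mul_one, trace_sub] at h
  exact h

/-- A maximizer of a quotient of weighted quantities dominates the quotient of their averages. -/
theorem mul_le_mul_of_forall_quotient_le {κ a s T : ℝ} {p q r : Fin n → ℝ} (hp : ∀ i, 0 ≤ p i)
    (hpκ : ∑ i, p i = κ) (ha : 0 ≤ a) (hs : 0 ≤ s) (hr : ∑ i, p i * r i ≤ T)
    (h : ∀ j, q j ≤ (1 + a * r j) * s) : ∑ i, p i * q i ≤ (κ + a * T) * s := by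
  calc ∑ i, p i * q i ≤ ∑ i, p i * ((1 + a * r i) * s) :=
        Finset.sum_le_sum fun i _ => mul_le_mul_of_nonneg_left (h i) (hp i)
    _ = (κ + a * ∑ i, p i * r i) * s := by
        rw [← hpκ, Finset.mul_sum, ← Finset.sum_add_distrib, Finset.sum_mul]
        exact Finset.sum_congr rfl fun i _ => by ring
    _ ≤ (κ + a * T) * s := by gcongr

theorem score_entropy_nonneg {α : ℝ} (hα : 0 < α) {B : Matrix (Fin d) (Fin d) ℝ}
    (hB : B.PosSemidef) (x : Fin d → ℝ) : 0 ≤ score .entropy α B x := by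
  have hx : 0 ≤ x ⬝ᵥ x := by simpa using dotProduct_star_self_nonneg x
  have h1 : Real.exp (-(α * (x ⬝ᵥ x))) ≤ 1 := Real.exp_le_one_iff.2 (by simp; positivity)
  exact mul_nonneg (by linarith) (div_nonneg (dotProduct_mulVec_nonneg hB x) hx)

/-- Since 1 - e^{-x} ≥ x/(1+x), the entropy score dominates a quotient of the same shape as the
ℓ_{1/2} score, so one averaging lemma serves both regularizers. -/
theorem mul_dotProduct_le_score_entropy {α : ℝ} (hα : 0 < α) {B : Matrix (Fin d) (Fin d) ℝ}
    (hB : B.PosSemidef) (x : Fin d → ℝ) :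
    α * (x ⬝ᵥ (B *ᵥ x)) ≤ (1 + α * (x ⬝ᵥ x)) * score .entropy α B x := by
  have hx : 0 ≤ x ⬝ᵥ x := by simpa using dotProduct_star_self_nonneg x
  rcases eq_or_lt_of_le hx with h0 | hpos
  · have : x = 0 := dotProduct_self_eq_zero.1 h0.symm
    subst this
    simp [score]
  · have hq := dotProduct_mulVec_nonneg hB x
    simp only [score]
    set r := x ⬝ᵥ x
    set q := x ⬝ᵥ (B *ᵥ x)
    have hαr : 0 < α * r := by positivity
    have h1 : Real.exp (-(α * r)) * (1 + α * r) ≤ 1 := by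
      rw [Real.exp_neg, inv_mul_le_one₀ (Real.exp_pos _)]
      linarith [Real.add_one_le_exp (α * r)]
    have h2 : α * r ≤ (1 + α * r) * (1 - Real.exp (-(α * r))) := by linarith
    calc α * q = α * r * (q / r) := by field_simp
      _ ≤ (1 + α * r) * (1 - Real.exp (-(α * r))) * (q / r) := by gcongr
      _ = _ := by ring

/-- One round with the entropy regularizer decreases the normalized potential. -/
theorem trace_mexp_step_le {κ α : ℝ} (hκ : 0 < κ) (hα : 0 < α) (hd : 0 < d)
    (hακ : (Real.exp (α / κ) - 1) * κ ≤ α * d)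
    {H C : Matrix (Fin d) (Fin d) ℝ} (hH : H.IsHermitian) (hHt : (mexp H).trace = 1)
    (hC : C.PosSemidef) {y : Fin n → Fin d → ℝ} {p : Fin n → ℝ} (hp : ∀ i, 0 ≤ p i)
    (hpκ : ∑ i, p i = κ) (hy : ∑ i, p i • vecMulVec (y i) (y i) = 1 - κ • C) (i : Fin n)
    (hi : ∀ j, score .entropy α (mexp (H - α • C)) (y j) ≤
      score .entropy α (mexp (H - α • C)) (y i)) :
    (mexp (H - α • (vecMulVec (y i) (y i) + C))).trace ≤ 1 - α / (κ + α * d) := by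
  have hCκ := one_div_smul_one_sub_posSemidef hκ hp hy
  have hαC : (α • C).IsHermitian := hC.isHermitian.smul (by simp [IsSelfAdjoint])
  have hHC : (H - α • C).IsHermitian := hH.sub hαC
  set B := mexp (H - α • C) with hBdef
  have hB : B.PosSemidef := posSemidef_mexp _
  set c := (B * C).trace with hc
  have hc0 : 0 ≤ c := trace_mul_nonneg hB hC
  set s := score .entropy α B (y i) with hs
  have hs0 : 0 ≤ s := score_entropy_nonneg hα hB _
  have h1 : B.trace + α * c ≤ 1 := by
    have h := trace_mexp_add_le hH hHC
    rwa [sub_sub_cancel, smul_mul_assoc, trace_smul, trace_mul_comm, hHt, smul_eq_mul] at h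
  -- The converse of `h1` up to a factor d: the ridge update is undone by Golden–Thompson with a
  -- chord on [0, 1/κ], whose slope is controlled by `hακ`.
  have h2 : 1 ≤ B.trace + α * d * c := by
    have h := trace_mexp_add_smul_le α (inv_pos.2 hκ) hHC hC hCκ
    rw [sub_add_cancel, hHt] at h
    refine h.trans ?_
    rw [← div_eq_mul_inv, div_inv_eq_mul]
    gcongr
  -- The chord slope on [0, ‖y‖²] at rate -α, times the quadratic form of B, is exactly minus the
  -- entropy score.
  have h3 : (mexp (H - α • (vecMulVec (y i) (y i) + C))).trace ≤ B.trace - s := by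
    have e : H - α • (vecMulVec (y i) (y i) + C) = H - α • C + (-α) • vecMulVec (y i) (y i) := by
      rw [smul_add, neg_smul]; abel
    rw [e]
    have hy0 : 0 ≤ y i ⬝ᵥ y i := by simpa using dotProduct_star_self_nonneg (y i)
    rcases eq_or_lt_of_le hy0 with h0 | hpos
    · have : y i = 0 := dotProduct_self_eq_zero.1 h0.symm
      rw [hs, this]
      simp [score, hBdef]
    · refine (trace_mexp_add_smul_le (-α) hpos hHC (vecMulVec_posSemidef _)
        (smul_one_sub_vecMulVec_posSemidef _)).trans_eq ?_
      rw [trace_mul_vecMulVec, hs, score, neg_mul]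
      ring
  have h4 : α * (B.trace - κ * c) ≤ (κ + α * d) * s := by
    have hr : ∑ i, p i * (y i ⬝ᵥ y i) ≤ d := by
      have h := sum_mul_dotProduct_mulVec hy 1
      simp only [one_mulVec, one_mul, trace_one, Fintype.card_fin] at h
      rw [h]
      nlinarith [hC.trace_nonneg]
    have h := mul_le_mul_of_forall_quotient_le hp hpκ hα.le hs0 hr
      (q := fun j => α * (y j ⬝ᵥ (B *ᵥ y j))) fun j =>
        (mul_dotProduct_le_score_entropy hα hB (y j)).trans
          (mul_le_mul_of_nonneg_left (hi j) (by
            have : 0 ≤ y j ⬝ᵥ y j := by simpa using dotProduct_star_self_nonneg (y j)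
            positivity))
    rw [← sum_mul_dotProduct_mulVec hy, Finset.mul_sum]
    refine le_trans (le_of_eq (Finset.sum_congr rfl fun j _ => by ring)) h
  have hd' : (0 : ℝ) < d := by exact_mod_cast hd
  have hD : 0 < κ + α * d := by positivity
  refine h3.trans ?_
  rw [le_sub_iff_add_le, ← le_sub_iff_add_le', div_le_iff₀ hD]
  -- Add (κ + αd) times `h1`, α times `h2`, and `h4`; the terms ακc cancel.
  nlinarith

/-- The Sherman–Morrison formula, in trace form. -/
theorem trace_inv_add_vecMulVec {Z : Matrix (Fin d) (Fin d) ℝ} (hZ : Z.PosDef) {α : ℝ}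
    (hα : 0 < α) (x : Fin d → ℝ) :
    ((Z + α • vecMulVec x x)⁻¹).trace =
      (Z⁻¹).trace - α * ((x ⬝ᵥ ((Z⁻¹ * Z⁻¹) *ᵥ x)) / (1 + α * (x ⬝ᵥ (Z⁻¹ *ᵥ x)))) := by
  have hu := (isUnit_iff_isUnit_det _).1 hZ.isUnit
  have hq := dotProduct_mulVec_nonneg hZ.inv.posSemidef x
  set q := x ⬝ᵥ (Z⁻¹ *ᵥ x) with hqdef
  have hD : 0 < 1 + α * q := by positivity
  have hsq : vecMulVec x x * Z⁻¹ * vecMulVec x x = q • vecMulVec x x := by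
    rw [mul_assoc, mul_vecMulVec, vecMulVec_mul_vecMulVec, vecMulVec_smul]
  have hinv : (Z + α • vecMulVec x x)⁻¹ =
      Z⁻¹ - (α / (1 + α * q)) • (Z⁻¹ * vecMulVec x x * Z⁻¹) := by
    refine inv_eq_left_inv ?_
    have h1 : Z⁻¹ * vecMulVec x x * Z⁻¹ * Z = Z⁻¹ * vecMulVec x x := by
      rw [mul_assoc, nonsing_inv_mul _ hu, mul_one]
    have h2 : Z⁻¹ * vecMulVec x x * Z⁻¹ * vecMulVec x x = q • (Z⁻¹ * vecMulVec x x) := by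
      rw [mul_assoc (Z⁻¹), mul_assoc, hsq, mul_smul_comm]
    rw [sub_mul, mul_add, mul_add, nonsing_inv_mul _ hu, mul_smul_comm, smul_mul_assoc, h1,
      smul_mul_assoc, mul_smul_comm, h2]
    simp only [smul_smul]
    rw [← add_smul]
    have : α / (1 + α * q) + α / (1 + α * q) * (α * q) = α := by field_simp
    rw [this, add_sub_cancel_right]
  rw [hinv, trace_sub, trace_smul, trace_mul_comm, ← mul_assoc, trace_mul_vecMulVec, smul_eq_mul]
  ring

theorem trace_inv_le_sqrt {Y : Matrix (Fin d) (Fin d) ℝ} (hY : Y.PosDef)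
    (hYt : (Y⁻¹ * Y⁻¹).trace = 1) : (Y⁻¹).trace ≤ √d := by
  have hs : Y⁻¹ᵀ = Y⁻¹ := hY.inv.isHermitian
  rcases Nat.eq_zero_or_pos d with rfl | hd
  · simp [Matrix.trace]
  have hd' : (0 : ℝ) < d := by exact_mod_cast hd
  have hr : 0 < √(d : ℝ) := Real.sqrt_pos.2 hd'
  have h := two_mul_trace_mul_le ((√(d : ℝ))⁻¹ • (1 : Matrix (Fin d) (Fin d) ℝ)) Y⁻¹
  have hone : (√(d : ℝ))⁻¹ * ((√(d : ℝ))⁻¹ * d) = 1 := by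
    rw [← mul_assoc, ← mul_inv, Real.mul_self_sqrt hd'.le, inv_mul_cancel₀ hd'.ne']
  simp only [hs, hYt, transpose_smul, transpose_one, smul_mul_assoc, mul_smul_comm, one_mul,
    trace_smul, trace_one, Fintype.card_fin, smul_eq_mul, hone] at h
  rw [inv_mul_eq_div] at h
  have : (Y⁻¹).trace / √d ≤ 1 := by linarith
  rwa [div_le_one hr] at this

/-- With S = Y⁻¹, the normalization gives Tr S³ ≤ 1, hence Tr(S³C) ≤ v. The tangent bound for (Y +
C)⁻¹ at sS, with s = (1+v)⁻¹ the best multiple, yields Tr(S(Y+C)⁻¹) ≥ s, and Cauchy–Schwarz against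
sS finishes. -/
theorem trace_inv_mul_inv_add_ge {Y C : Matrix (Fin d) (Fin d) ℝ} {v : ℝ} (hv : 0 ≤ v)
    (hY : Y.PosDef) (hYt : (Y⁻¹ * Y⁻¹).trace = 1) (hC : C.PosSemidef)
    (hCv : (v • (1 : Matrix (Fin d) (Fin d) ℝ) - C).PosSemidef) :
    ((1 + v)⁻¹) ^ 2 ≤ ((Y + C)⁻¹ * (Y + C)⁻¹).trace := by
  have hZ : (Y + C).PosDef := hY.add_posSemidef hC
  have hu := (isUnit_iff_isUnit_det _).1 hY.isUnit
  set S := Y⁻¹ with hS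
  have hSp : S.PosSemidef := hY.inv.posSemidef
  have hSt : Sᵀ = S := hSp.isHermitian
  have hZt : (Y + C)⁻¹ᵀ = (Y + C)⁻¹ := hZ.inv.isHermitian
  have hS2 : (S * S).PosSemidef := by simpa [pow_two] using hSp.pow 2
  have hS3 : (S * S * S).PosSemidef := by simpa [pow_succ] using hSp.pow 3
  have h3 : (S * S * S).trace ≤ 1 := by
    have h1 := two_mul_trace_mul_le (S * S) S
    have h2 := trace_mul_le_trace_mul_trace hS2 hS2
    rw [transpose_mul, hSt, hYt] at h1
    rw [hYt] at h2
    linarith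
  have h4 : (S * S * S * C).trace ≤ v := by
    have h := trace_mul_nonneg hS3 hCv
    rw [mul_sub, mul_smul_comm, mul_one, trace_sub, trace_smul, smul_eq_mul] at h
    nlinarith
  set s := (1 + v)⁻¹ with hs
  have hs1 : s * (1 + v) = 1 := inv_mul_cancel₀ (by positivity)
  have hs0 : 0 < s := by positivity
  have h5 : s ≤ (S * (Y + C)⁻¹).trace := by
    have hX : (s • S).IsHermitian := hSp.isHermitian.smul (by simp [IsSelfAdjoint])
    have h := trace_mul_nonneg hSp (inv_sub_tangent_posSemidef hZ hX)
    have e : (S * (s • S * (Y + C) * (s • S))).trace = s ^ 2 * (1 + (S * S * S * C).trace) := by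
      simp only [smul_mul_assoc, mul_smul_comm, trace_smul, smul_eq_mul]
      have e1 : S * (Y + C) * S = S + S * C * S := by
        rw [mul_add, add_mul, nonsing_inv_mul _ hu, one_mul]
      have e2 : (S * (S * C * S)).trace = (S * S * S * C).trace := by
        rw [← mul_assoc, trace_mul_comm]; simp only [mul_assoc]
      rw [e1, mul_add, trace_add, hYt, e2]
      ring
    rw [mul_sub, mul_sub, trace_sub, trace_sub, e, mul_smul_comm, mul_smul_comm, trace_smul,
      trace_smul, hYt, smul_eq_mul, smul_eq_mul] at h
    have : s ^ 2 * (1 + (S * S * S * C).trace) ≤ s := by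
      calc s ^ 2 * (1 + (S * S * S * C).trace) ≤ s ^ 2 * (1 + v) := by gcongr
        _ = s * (s * (1 + v)) := by ring
        _ = s := by rw [hs1, mul_one]
    linarith
  have h6 := two_mul_trace_mul_le (s • S) (Y + C)⁻¹
  simp only [hZt, hSt, transpose_smul, smul_mul_assoc, mul_smul_comm, trace_smul, hYt,
    smul_eq_mul, mul_one] at h6
  nlinarith

/-- One round with the `ℓ_{1/2}` regularizer increases the dual potential. -/
theorem trace_inv_step_le {κ α : ℝ} (hκ : 0 < κ) (hα : 0 < α)
    {Y C : Matrix (Fin d) (Fin d) ℝ} (hY : Y.PosDef) (hYt : (Y⁻¹ * Y⁻¹).trace = 1)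
    (hC : C.PosSemidef) {y : Fin n → Fin d → ℝ} {p : Fin n → ℝ} (hp : ∀ i, 0 ≤ p i)
    (hpκ : ∑ i, p i = κ) (hy : ∑ i, p i • vecMulVec (y i) (y i) = 1 - κ • C) (i : Fin n)
    (hi : ∀ j, score .half α (mpow (Y + α • C) (-2)) (y j) ≤
      score .half α (mpow (Y + α • C) (-2)) (y i)) :
    ((Y + α • (vecMulVec (y i) (y i) + C))⁻¹).trace ≤
      (Y⁻¹).trace - α * (((1 + α / κ)⁻¹) ^ 2 / (κ + α * √d)) := by
  have hCκ := one_div_smul_one_sub_posSemidef hκ hp hy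
  have hαC : (α • C).PosSemidef := hC.smul hα.le
  have hZ : (Y + α • C).PosDef := hY.add_posSemidef hαC
  have hg : ((1 + α / κ)⁻¹) ^ 2 ≤ ((Y + α • C)⁻¹ * (Y + α • C)⁻¹).trace := by
    refine trace_inv_mul_inv_add_ge (by positivity) hY hYt hαC ?_
    have h := hCκ.smul hα.le
    rwa [smul_sub, smul_smul, ← div_eq_mul_inv] at h
  have hhalf : mpow (mpow (Y + α • C) (-2)) (1 / 2) = (Y + α • C)⁻¹ := by
    rw [mpow_mpow hZ, ← mpow_neg_one hZ]; norm_num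
  have hconv := trace_inv_add_le hY hZ
  set Z := Y + α • C with hZdef
  have hu := (isUnit_iff_isUnit_det _).1 hZ.isUnit
  have hZ2 : (Z⁻¹ * Z⁻¹).PosSemidef := by simpa [pow_two] using hZ.inv.posSemidef.pow 2
  set c := (Z⁻¹ * Z⁻¹ * C).trace with hc
  have hc0 : 0 ≤ c := trace_mul_nonneg hZ2 hC
  have h1 : (Z⁻¹).trace + α * c ≤ (Y⁻¹).trace := by
    have e : (Z⁻¹ * Z⁻¹ * Y).trace = (Z⁻¹).trace - α * c := by
      have : Y = Z - α • C := by rw [hZdef, add_sub_cancel_right]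
      rw [this, mul_sub, mul_assoc, nonsing_inv_mul _ hu, mul_one, trace_sub, mul_smul_comm,
        trace_smul, smul_eq_mul]
    linarith
  have hsc (x : Fin d → ℝ) : score .half α (mpow Z (-2)) x =
      (x ⬝ᵥ ((Z⁻¹ * Z⁻¹) *ᵥ x)) / (1 + α * (x ⬝ᵥ (Z⁻¹ *ᵥ x))) := by
    rw [score, hhalf, mpow_neg_two hZ]
  have hq (x : Fin d → ℝ) := dotProduct_mulVec_nonneg hZ2 x
  have hr (x : Fin d → ℝ) := dotProduct_mulVec_nonneg hZ.inv.posSemidef x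
  have hpos (x : Fin d → ℝ) : 0 < 1 + α * (x ⬝ᵥ (Z⁻¹ *ᵥ x)) := by have := hr x; positivity
  have h2 := trace_inv_add_vecMulVec hZ hα (y i)
  rw [← hsc] at h2
  set s := score .half α (mpow Z (-2)) (y i) with hs
  have hs0 : 0 ≤ s := by rw [hs, hsc]; exact div_nonneg (hq _) (hpos _).le
  have h3 : (Z⁻¹ * Z⁻¹).trace - κ * c ≤ (κ + α * √d) * s := by
    have hrd : ∑ i, p i * (y i ⬝ᵥ (Z⁻¹ *ᵥ y i)) ≤ √d := by
      rw [sum_mul_dotProduct_mulVec hy]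
      have := trace_mul_nonneg hZ.inv.posSemidef hC
      have := trace_inv_le_sqrt hY hYt
      nlinarith
    rw [hc, ← sum_mul_dotProduct_mulVec hy]
    refine mul_le_mul_of_forall_quotient_le hp hpκ hα.le hs0 hrd fun j => ?_
    have h := hi j
    rw [hsc, div_le_iff₀ (hpos _)] at h
    linarith
  have e : Y + α • (vecMulVec (y i) (y i) + C) = Z + α • vecMulVec (y i) (y i) := by
    rw [hZdef, smul_add]; abel
  have hD : 0 < κ + α * √d := by positivity
  rw [e, h2]
  -- Multiplying `c + s` by the denominator, the κc term cancels the deficit in `h3`, and `hg`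
  -- bounds what remains.
  have h4 : ((1 + α / κ)⁻¹) ^ 2 / (κ + α * √d) ≤ c + s := by
    rw [div_le_iff₀ hD]
    have : 0 ≤ α * √d * c := by positivity
    nlinarith
  nlinarith

end Steps

/-! ### From one round to k rounds: spectral lower bound on the cumulative loss -/

section Rounding

variable {n d : ℕ}

theorem sum_Iio_induction {M : Type*} [AddCommMonoid M] {k : ℕ} (ℓ : Fin k → M)
    (Q : ℕ → M → Prop) (h0 : Q 0 0)
    (hstep : ∀ t : Fin k, Q t (∑ s ∈ Finset.Iio t, ℓ s) →
      Q (t + 1) (∑ s ∈ Finset.Iio t, ℓ s + ℓ t)) : Q k (∑ s, ℓ s) := by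
  have key : ∀ m ≤ k, Q m (∑ s with s.val < m, ℓ s) := by
    intro m
    induction m with
    | zero => intro _; simpa using h0
    | succ m ih =>
      intro hm
      have hIio : (Finset.univ.filter fun s : Fin k => s.val < m) = Finset.Iio ⟨m, hm⟩ := by
        ext s; simp [Fin.lt_def]
      have hsucc : (Finset.univ.filter fun s : Fin k => s.val < m + 1) =
          insert ⟨m, hm⟩ (Finset.Iio ⟨m, hm⟩) := by
        ext s
        simp only [Finset.mem_filter, Finset.mem_univ, true_and, Finset.mem_insert,
          Finset.mem_Iio, Fin.lt_def, Fin.ext_iff]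
        omega
      have h := ih (by omega)
      rw [hIio] at h
      rw [hsucc, Finset.sum_insert (by simp), add_comm (ℓ _)]
      exact hstep ⟨m, hm⟩ h
  have h := key k le_rfl
  simpa using h

theorem trace_mexp_sub_smul_one {G : Matrix (Fin d) (Fin d) ℝ} (hG : G.IsHermitian) (ν : ℝ) :
    (mexp (G - ν • 1)).trace = Real.exp (-ν) * (mexp G).trace := by
  have hsa : IsSelfAdjoint G := hG
  have e : G - ν • 1 = cfc (fun x : ℝ => x - ν) G := by
    have h := cfc_affine hG (-ν) 1
    rw [neg_smul, one_smul, neg_add_eq_sub] at h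
    rw [← h]
    congr 1
    ext x
    ring
  rw [e, mexp, ← cfc_comp' Real.exp (fun x : ℝ => x - ν) G, mexp, ← smul_eq_mul, ← trace_smul,
    ← cfc_const_mul (Real.exp (-ν)) Real.exp G]
  congr 2
  ext x
  rw [← Real.exp_add]
  ring_nf

/-- The exponential lies below its trace times I and above its tangent line at -ατ; comparing the
two bounds L. -/
theorem sub_smul_one_posSemidef_of_trace_mexp_le {L : Matrix (Fin d) (Fin d) ℝ} {α τ : ℝ}
    (hα : 0 < α) (hL : L.IsHermitian) (h : (mexp (-(α • L))).trace ≤ Real.exp (-(α * τ))) :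
    (L - τ • (1 : Matrix (Fin d) (Fin d) ℝ)).PosSemidef := by
  have hαL : (-(α • L)).IsHermitian := (hL.smul (by simp [IsSelfAdjoint])).neg
  refine posSemidef_of_dotProduct_nonneg (hL.sub (isHermitian_one.smul (by simp [IsSelfAdjoint])))
    fun u => ?_
  have h1 := dotProduct_mulVec_nonneg (trace_smul_one_sub_posSemidef (posSemidef_mexp (-(α • L)))) u
  have h2 := dotProduct_mulVec_nonneg (mexp_sub_tangent_posSemidef hαL (-(α * τ))) u
  have hu : 0 ≤ u ⬝ᵥ u := by simpa using dotProduct_star_self_nonneg u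
  simp only [sub_mulVec, add_mulVec, smul_mulVec, one_mulVec, neg_mulVec, dotProduct_sub,
    dotProduct_add, dotProduct_neg, dotProduct_smul, smul_eq_mul] at h1 h2 ⊢
  have hE := Real.exp_pos (-(α * τ))
  have h3 : Real.exp (-(α * τ)) * ((1 - -(α * τ)) * (u ⬝ᵥ u) + -(α * u ⬝ᵥ L *ᵥ u)) ≤
      Real.exp (-(α * τ)) * (u ⬝ᵥ u) := by
    have := mul_le_mul_of_nonneg_right h hu
    linarith
  have h4 := le_of_mul_le_mul_left h3 hE
  have h5 : 0 ≤ α * (u ⬝ᵥ L *ᵥ u - τ * u ⬝ᵥ u) := by linarith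
  exact nonneg_of_mul_nonneg_right h5 hα

/-- For Y = αL + νI, squeeze Y⁻¹ between its tangent 2I - Y at the identity and Tr(Y⁻¹) I; ν
cancels. -/
theorem sub_smul_one_posSemidef_of_trace_inv_le {L : Matrix (Fin d) (Fin d) ℝ} {α τ ν : ℝ}
    (hα : 0 < α) (hL : L.IsHermitian) (hY : (α • L + ν • (1 : Matrix (Fin d) (Fin d) ℝ)).PosDef)
    (h : ((α • L + ν • (1 : Matrix (Fin d) (Fin d) ℝ))⁻¹).trace + ν ≤ 2 - α * τ) :
    (L - τ • (1 : Matrix (Fin d) (Fin d) ℝ)).PosSemidef := by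
  refine posSemidef_of_dotProduct_nonneg (hL.sub (isHermitian_one.smul (by simp [IsSelfAdjoint])))
    fun u => ?_
  have h1 := dotProduct_mulVec_nonneg (trace_smul_one_sub_posSemidef hY.inv.posSemidef) u
  have h2 := dotProduct_mulVec_nonneg (inv_sub_tangent_posSemidef hY isHermitian_one) u
  have hu : 0 ≤ u ⬝ᵥ u := by simpa using dotProduct_star_self_nonneg u
  simp only [one_mul, mul_one, sub_mulVec, add_mulVec, smul_mulVec, one_mulVec, dotProduct_sub,
    dotProduct_add, dotProduct_smul, smul_eq_mul] at h1 h2 ⊢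
  have h3 := mul_le_mul_of_nonneg_right h hu
  have h5 : 0 ≤ α * (u ⬝ᵥ L *ᵥ u - τ * u ⬝ᵥ u) := by linarith
  exact nonneg_of_mul_nonneg_right h5 hα

/-- The regret guarantee of the rounding stage with the entropy regularizer. -/
theorem sum_loss_entropy {k : ℕ} {α τ : ℝ} (hk : 0 < k) (hd : 0 < d) (hα : 0 < α)
    (hαk : (Real.exp (α / k) - 1) * k ≤ α * d)
    (hτ : α * τ ≤ k * (α / (k + α * d)) - Real.log d)
    {C : Matrix (Fin d) (Fin d) ℝ} (hC : C.PosSemidef)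
    {y : Fin n → Fin d → ℝ} {p : Fin n → ℝ} (hp : ∀ i, 0 ≤ p i)
    (hpk : ∑ i, p i = k) (hy : ∑ i, p i • vecMulVec (y i) (y i) = 1 - (k : ℝ) • C)
    (idx : Fin k → Fin n) (A : Fin k → Matrix (Fin d) (Fin d) ℝ)
    (hA : ∀ t, IsAction .entropy α
      (∑ s ∈ Finset.Iio t, (vecMulVec (y (idx s)) (y (idx s)) + C)) (A t))
    (hidx : ∀ t j, score .entropy α (mexp (mlog (A t) - α • C)) (y j) ≤
      score .entropy α (mexp (mlog (A t) - α • C)) (y (idx t))) :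
    ((∑ s, (vecMulVec (y (idx s)) (y (idx s)) + C)) -
      τ • (1 : Matrix (Fin d) (Fin d) ℝ)).PosSemidef := by
  have hd' : (0 : ℝ) < d := by exact_mod_cast hd
  have hk' : (0 : ℝ) < k := by exact_mod_cast hk
  have hℓ (s : Fin k) : (vecMulVec (y (idx s)) (y (idx s)) + C).IsHermitian :=
    (vecMulVec_posSemidef _).isHermitian.add hC.isHermitian
  have hβ : 0 ≤ 1 - α / (k + α * d) := by
    have hd1 : (1 : ℝ) ≤ d := by exact_mod_cast hd
    rw [sub_nonneg, div_le_one (by positivity)]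
    nlinarith
  have hQ := sum_Iio_induction (fun s => vecMulVec (y (idx s)) (y (idx s)) + C)
    (fun m L => L.IsHermitian ∧
      (mexp (-(α • L))).trace ≤ d * (1 - α / (k + α * d)) ^ m) ?_ ?_
  · refine sub_smul_one_posSemidef_of_trace_mexp_le hα hQ.1 (hQ.2.trans ?_)
    calc (d : ℝ) * (1 - α / (k + α * d)) ^ k
        ≤ Real.exp (Real.log d) * Real.exp (-(α / (k + α * d))) ^ k := by
          rw [Real.exp_log hd']
          gcongr
          linarith [Real.add_one_le_exp (-(α / (k + α * d)))]
      _ = Real.exp (Real.log d - k * (α / (k + α * d))) := by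
          rw [← Real.exp_nat_mul, ← Real.exp_add]; ring_nf
      _ ≤ _ := Real.exp_le_exp.2 (by linarith)
  · refine ⟨isHermitian_zero, ?_⟩
    have hsa : IsSelfAdjoint (0 : Matrix (Fin d) (Fin d) ℝ) := isHermitian_zero
    rw [smul_zero, neg_zero, mexp_eq_exp isHermitian_zero, NormedSpace.exp_zero]
    simp
  · rintro t ⟨hL, hle⟩
    set L := ∑ s ∈ Finset.Iio t, (vecMulVec (y (idx s)) (y (idx s)) + C)
    refine ⟨hL.add (hℓ t), ?_⟩
    obtain ⟨ν, hAν, htr⟩ := hA t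
    have hαL (M : Matrix (Fin d) (Fin d) ℝ) (hM : M.IsHermitian) : (-(α • M)).IsHermitian :=
      (hM.smul (by simp [IsSelfAdjoint])).neg
    have hH : (-(α • L) - ν • (1 : Matrix (Fin d) (Fin d) ℝ)).IsHermitian :=
      (hαL L hL).sub (isHermitian_one.smul (by simp [IsSelfAdjoint]))
    have hlog : mlog (A t) = -(α • L) - ν • 1 := by rw [hAν, mlog_mexp hH]
    have hsel := hidx t
    rw [hlog] at hsel
    rw [hAν] at htr
    have hstep := trace_mexp_step_le hk' hα hd hαk hH htr hC hp hpk hy (idx t) hsel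
    have e : -(α • L) - ν • (1 : Matrix (Fin d) (Fin d) ℝ) -
        α • (vecMulVec (y (idx t)) (y (idx t)) + C) =
        -(α • (L + (vecMulVec (y (idx t)) (y (idx t)) + C))) - ν • 1 := by
      rw [smul_add α L]; abel
    rw [e, trace_mexp_sub_smul_one (hαL _ (hL.add (hℓ t)))] at hstep
    rw [trace_mexp_sub_smul_one (hαL _ hL)] at htr
    -- The normalizer e^ν is the unnormalized potential itself, so the additive gain of a trace-one
    -- round becomes a multiplicative decrease.
    have hZ : (mexp (-(α • L))).trace = Real.exp ν := by
      rw [Real.exp_neg] at htr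
      exact (inv_mul_eq_one₀ (Real.exp_pos ν).ne').1 htr |>.symm
    rw [Real.exp_neg, inv_mul_le_iff₀ (Real.exp_pos ν), ← hZ] at hstep
    refine hstep.trans ?_
    rw [pow_succ, ← mul_assoc]
    gcongr

/-- The regret guarantee of the rounding stage with the `ℓ_{1/2}` regularizer. -/
theorem sum_loss_half {k : ℕ} {α τ : ℝ} (hk : 0 < k) (hd : 0 < d) (hα : 0 < α)
    (hτ : α * τ ≤ 2 - 2 * √d + k * (α * (((1 + α / k)⁻¹) ^ 2 / (k + α * √d))))
    {C : Matrix (Fin d) (Fin d) ℝ} (hC : C.PosSemidef)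
    {y : Fin n → Fin d → ℝ} {p : Fin n → ℝ} (hp : ∀ i, 0 ≤ p i)
    (hpk : ∑ i, p i = k) (hy : ∑ i, p i • vecMulVec (y i) (y i) = 1 - (k : ℝ) • C)
    (idx : Fin k → Fin n) (A : Fin k → Matrix (Fin d) (Fin d) ℝ)
    (hA : ∀ t, IsAction .half α
      (∑ s ∈ Finset.Iio t, (vecMulVec (y (idx s)) (y (idx s)) + C)) (A t))
    (hidx : ∀ t j, score .half α (mpow (mpow (A t) (-1 / 2) + α • C) (-2)) (y j) ≤
      score .half α (mpow (mpow (A t) (-1 / 2) + α • C) (-2)) (y (idx t))) :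
    ((∑ s, (vecMulVec (y (idx s)) (y (idx s)) + C)) -
      τ • (1 : Matrix (Fin d) (Fin d) ℝ)).PosSemidef := by
  have hd' : (0 : ℝ) < d := by exact_mod_cast hd
  have hk' : (0 : ℝ) < k := by exact_mod_cast hk
  have hℓ (s : Fin k) : (vecMulVec (y (idx s)) (y (idx s)) + C).PosSemidef :=
    (vecMulVec_posSemidef _).add hC
  set γ : ℝ := α * (((1 + α / k)⁻¹) ^ 2 / (k + α * √d)) with hγ
  have hQ := sum_Iio_induction (fun s => vecMulVec (y (idx s)) (y (idx s)) + C)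
    (fun m L => L.IsHermitian ∧ ∃ ν : ℝ, (α • L + ν • (1 : Matrix (Fin d) (Fin d) ℝ)).PosDef ∧
      ((α • L + ν • (1 : Matrix (Fin d) (Fin d) ℝ))⁻¹).trace + ν ≤ 2 * √d - m * γ) ?_ ?_
  · obtain ⟨hL, ν, hY, hle⟩ := hQ
    exact sub_smul_one_posSemidef_of_trace_inv_le hα hL hY (by linarith)
  · have hr : 0 < √(d : ℝ) := Real.sqrt_pos.2 hd'
    -- At L = 0 the potential is d/ν + ν, minimized at ν = √d with value 2√d.
    refine ⟨isHermitian_zero, √d, ?_, ?_⟩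
    · rw [smul_zero, zero_add]
      exact PosDef.one.smul hr
    · have hinv : (√(d : ℝ) • (1 : Matrix (Fin d) (Fin d) ℝ))⁻¹ = (√(d : ℝ))⁻¹ • 1 := by
        refine inv_eq_left_inv ?_
        rw [smul_mul_smul_comm, inv_mul_cancel₀ hr.ne', one_mul, one_smul]
      rw [smul_zero, zero_add, hinv, trace_smul, trace_one, Fintype.card_fin, smul_eq_mul]
      have : (√(d : ℝ))⁻¹ * d = √d := by
        rw [inv_mul_eq_div, Real.div_sqrt]
      rw [this]
      simp
      linarith
  · rintro t ⟨hL, ν', hY', hle⟩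
    obtain ⟨ν, hY, hAν, htr⟩ := hA t
    set L := ∑ s ∈ Finset.Iio t, (vecMulVec (y (idx s)) (y (idx s)) + C)
    refine ⟨hL.add (hℓ t).isHermitian, ?_⟩
    have hpow : mpow (A t) (-1 / 2) = α • L + ν • 1 := by
      rw [hAν, mpow_mpow hY]
      norm_num [mpow_one hY]
    rw [hAν, mpow_neg_two hY] at htr
    have hsel := hidx t
    rw [hpow] at hsel
    have hstep := trace_inv_step_le hk' hα hY htr hC hp hpk hy (idx t) hsel
    -- Since Tr Y⁻² = 1, the algorithm's ν minimizes Tr (αL + νI)⁻¹ + ν; the bound known for the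
    -- inherited ν' therefore passes to ν, which is then kept for the next loss.
    have hmax := trace_inv_add_le hY' hY
    have e : α • (L + (vecMulVec (y (idx t)) (y (idx t)) + C)) +
        ν • (1 : Matrix (Fin d) (Fin d) ℝ) =
        α • L + ν • 1 + α • (vecMulVec (y (idx t)) (y (idx t)) + C) := by
      rw [smul_add α L]; abel
    have e' : α • L + ν' • (1 : Matrix (Fin d) (Fin d) ℝ) =
        (α • L + ν • 1) + (ν' - ν) • 1 := by
      rw [sub_smul]; abel
    refine ⟨ν, ?_, ?_⟩
    · rw [e]
      exact hY.add_posSemidef ((hℓ t).smul hα.le)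
    · rw [e]
      have hu := (isUnit_iff_isUnit_det _).1 hY.isUnit
      nth_rewrite 2 [e'] at hmax
      rw [mul_add, mul_assoc, nonsing_inv_mul _ hu, mul_one, trace_add, mul_smul_comm, mul_one,
        trace_smul, htr, smul_eq_mul, mul_one] at hmax
      push_cast
      linarith

end Rounding

/-! ### Whitening, the approximation guarantee and scalar estimates -/

section Approximation

variable {n d : ℕ}

theorem transpose_mul_self_eq_sum_vecMulVec {m : Type*} [Fintype m] (X : Matrix m (Fin d) ℝ) :
    Xᵀ * X = ∑ i, vecMulVec (X i) (X i) := by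
  ext a b
  simp [mul_apply, Matrix.sum_apply, vecMulVec_apply]

theorem cov_posDef (X : Matrix (Fin n) (Fin d) ℝ) {lam : ℝ} (hlam : 0 < lam) {w : Fin n → ℝ}
    (hw : ∀ i, 0 ≤ w i) : (cov X lam w).PosDef :=
  PosDef.posSemidef_add
    (posSemidef_sum _ fun i _ => (vecMulVec_posSemidef (X i)).smul (hw i)) (PosDef.one.smul hlam)

theorem mpow_neg_half_mul_self {S : Matrix (Fin d) (Fin d) ℝ} (hS : S.PosDef) :
    mpow S (-1 / 2) * mpow S (-1 / 2) = S⁻¹ := by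
  rw [← mpow_add hS, ← mpow_neg_one hS]
  norm_num

theorem mpow_neg_half_conj {S : Matrix (Fin d) (Fin d) ℝ} (hS : S.PosDef) :
    mpow S (-1 / 2) * S * mpow S (-1 / 2) = 1 := by
  nth_rewrite 2 [← mpow_one hS]
  rw [← mpow_add hS, ← mpow_add hS, ← mpow_zero hS]
  norm_num

theorem vecMulVec_denoised (X : Matrix (Fin n) (Fin d) ℝ) (S : Matrix (Fin d) (Fin d) ℝ)
    (i : Fin n) : vecMulVec (denoised X S i) (denoised X S i) =
      mpow S (-1 / 2) * vecMulVec (X i) (X i) * mpow S (-1 / 2) := by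
  have h : (mpow S (-1 / 2))ᵀ = mpow S (-1 / 2) := isHermitian_mpow S (-1 / 2)
  rw [mul_vecMulVec, vecMulVec_mul, denoised]
  nth_rewrite 4 [← h]
  rw [vecMul_transpose]

theorem sum_smul_vecMulVec_denoised (X : Matrix (Fin n) (Fin d) ℝ) {lam : ℝ} {p : Fin n → ℝ}
    (hS : (cov X lam p).PosDef) :
    ∑ i, p i • vecMulVec (denoised X (cov X lam p) i) (denoised X (cov X lam p) i) =
      1 - lam • (cov X lam p)⁻¹ := by
  have e : ∑ i, p i • vecMulVec (X i) (X i) = cov X lam p - lam • 1 := by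
    rw [cov, add_sub_cancel_right]
  have h : ∑ i, p i • vecMulVec (denoised X (cov X lam p) i) (denoised X (cov X lam p) i) =
      mpow (cov X lam p) (-1 / 2) * (∑ i, p i • vecMulVec (X i) (X i)) *
        mpow (cov X lam p) (-1 / 2) := by
    rw [Finset.mul_sum, Finset.sum_mul]
    exact Finset.sum_congr rfl fun i _ => by
      rw [vecMulVec_denoised, mul_smul_comm, smul_mul_assoc]
  rw [h, e, mul_sub, sub_mul, mpow_neg_half_conj hS, mul_smul_comm, smul_mul_assoc, mul_one,
    mpow_neg_half_mul_self hS]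

theorem sum_loss_eq_conj (X : Matrix (Fin n) (Fin d) ℝ) (lam : ℝ) {k : ℕ} (hk : 0 < k)
    {S : Matrix (Fin d) (Fin d) ℝ} (hS : S.PosDef) (idx : Fin k → Fin n) :
    ∑ t, loss X lam k S (idx t) =
      mpow S (-1 / 2) * ((X.submatrix idx id)ᵀ * X.submatrix idx id +
        lam • (1 : Matrix (Fin d) (Fin d) ℝ)) * mpow S (-1 / 2) := by
  have hk' : (k : ℝ) ≠ 0 := by exact_mod_cast hk.ne'
  have e : (X.submatrix idx id)ᵀ * X.submatrix idx id =
      ∑ t, vecMulVec (X (idx t)) (X (idx t)) := transpose_mul_self_eq_sum_vecMulVec _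
  rw [e, mul_add, add_mul, Finset.mul_sum, Finset.sum_mul, mul_smul_comm, mul_one, smul_mul_assoc,
    mpow_neg_half_mul_self hS]
  simp only [loss, Finset.sum_add_distrib, vecMulVec_denoised, Finset.sum_const, Finset.card_univ,
    Fintype.card_fin]
  rw [← Nat.cast_smul_eq_nsmul ℝ, smul_smul, mul_div_cancel₀ _ hk']

/-- A spectral lower bound on the cumulative loss gives the approximation guarantee. -/
theorem criterion_le_of_sum_loss_posSemidef {k : ℕ} (hk : 0 < k)
    (X : Matrix (Fin n) (Fin d) ℝ) {lam : ℝ} (hlam : 0 < lam)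
    {f : Matrix (Fin d) (Fin d) ℝ → ℝ} (hf : IsCriterion f) {ε : ℝ} (hε : 0 < ε)
    {p : Fin n → ℝ} (hp : IsRelaxedSolution f X lam k p) (idx : Fin k → Fin n)
    (h : (∑ t, loss X lam k (cov X lam p) (idx t) -
      (1 + ε)⁻¹ • (1 : Matrix (Fin d) (Fin d) ℝ)).PosSemidef) :
    f ((X.submatrix idx id)ᵀ * X.submatrix idx id + lam • (1 : Matrix (Fin d) (Fin d) ℝ)) ≤
      (1 + ε) * optValue f X lam k := by
  have hS := cov_posDef X hlam hp.1.1
  have hM : ((X.submatrix idx id)ᵀ * X.submatrix idx id +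
      lam • (1 : Matrix (Fin d) (Fin d) ℝ)).PosDef :=
    PosDef.posSemidef_add (posSemidef_conjTranspose_mul_self _) (PosDef.one.smul hlam)
  rw [sum_loss_eq_conj X lam hk hS] at h
  set S := cov X lam p with hSdef
  set M := (X.submatrix idx id)ᵀ * X.submatrix idx id + lam • (1 : Matrix (Fin d) (Fin d) ℝ)
  set R := mpow S (-1 / 2) with hR
  have hRS : R * S * R = 1 := mpow_neg_half_conj hS
  have hRu : IsUnit R := by
    refine (isUnit_iff_isUnit_det _).2 (isUnit_det_of_left_inverse (B := R * S) hRS)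
  have hRstar : star R = R := isHermitian_mpow S (-1 / 2)
  have hε1 : (0 : ℝ) < 1 + ε := by linarith
  have hMS : (M - (1 + ε)⁻¹ • S).PosSemidef := by
    rw [← IsUnit.posSemidef_star_left_conjugate_iff hRu, hRstar, mul_sub, sub_mul, mul_smul_comm,
      smul_mul_assoc, hRS]
    exact h
  have h1 : f M ≤ f ((1 + ε)⁻¹ • S) :=
    hf.anti _ _ (hS.smul (inv_pos.2 hε1)) hM hMS
  have h2 := hf.sublinear S hS (1 + ε)⁻¹ (inv_pos.2 hε1) (inv_lt_one_of_one_lt₀ (by linarith))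
  rw [inv_inv] at h2
  obtain ⟨⟨s, hs, hsf⟩, -⟩ := optValue_isLeast f X lam k (idx ⟨0, hk⟩).pos
  have h3 : f S ≤ optValue f X lam k := by
    rw [← hsf]
    exact hp.2 _ ⟨fun i => Nat.cast_nonneg _, by rw [← Nat.cast_sum, hs.2]⟩
  calc f M ≤ (1 + ε) * f S := h1.trans h2
    _ ≤ _ := by gcongr

theorem entropy_rate_bound {d k α ε : ℝ} (hd : 2 ≤ d) (hε : 0 < ε) (hε1 : ε < 1)
    (hα : α = 4 * Real.log d / ε) (hk : 16 * d * Real.log d / ε ^ 2 ≤ k) :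
    0 < k ∧ 0 < α ∧ (Real.exp (α / k) - 1) * k ≤ α * d ∧
      α * (1 + ε)⁻¹ ≤ k * (α / (k + α * d)) - Real.log d := by
  have hl : 0 < Real.log d := Real.log_pos (by linarith)
  have hk0 : 0 < k := lt_of_lt_of_le (by positivity) hk
  have hα0 : 0 < α := by rw [hα]; positivity
  have hlog : Real.log d = α * (ε / 4) := by rw [hα]; field_simp
  have hαd : α * d ≤ k * (ε / 4) := by
    rw [hlog, div_le_iff₀ (by positivity)] at hk
    have : ε * (α * d) ≤ ε * (k * (ε / 4)) := by nlinarith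
    exact le_of_mul_le_mul_left this hε
  refine ⟨hk0, hα0, ?_, ?_⟩
  -- For x = α/k this gives e^x ≤ 1/(1-x) ≤ 1 + 2x, and d ≥ 2 absorbs the factor 2.
  · have hx : α / k ≤ 1 / 8 := by
      rw [div_le_iff₀ hk0]
      nlinarith
    have hx0 : 0 ≤ α / k := by positivity
    have h1 : Real.exp (α / k) ≤ 1 / (1 - α / k) := by
      have := Real.add_one_le_exp (-(α / k))
      rw [Real.exp_neg] at this
      rw [le_div_iff₀ (by linarith)]
      calc Real.exp (α / k) * (1 - α / k) ≤ Real.exp (α / k) * (Real.exp (α / k))⁻¹ := by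
            gcongr; linarith
        _ = 1 := mul_inv_cancel₀ (Real.exp_pos _).ne'
    have h2 : 1 / (1 - α / k) ≤ 1 + 2 * (α / k) := by
      rw [div_le_iff₀ (by linarith)]
      nlinarith
    calc (Real.exp (α / k) - 1) * k ≤ (2 * (α / k)) * k := by gcongr; linarith
      _ = α * 2 := by field_simp
      _ ≤ α * d := by gcongr
  · rw [hlog]
    have h1 : (1 + ε / 4)⁻¹ ≤ k / (k + α * d) := by
      rw [inv_eq_one_div, div_le_div_iff₀ (by positivity) (by positivity)]
      linarith
    have h2 : (1 + ε)⁻¹ ≤ (1 + ε / 4)⁻¹ - ε / 4 := by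
      rw [inv_eq_one_div, inv_eq_one_div, div_sub' (by positivity),
        div_le_div_iff₀ (by positivity) (by positivity)]
      nlinarith
    calc α * (1 + ε)⁻¹ ≤ α * (k / (k + α * d) - ε / 4) := by gcongr; linarith
      _ = _ := by ring

/-- The final ℓ_{1/2} inequality with denominators cleared. Using ε² ≤ ε makes the left side affine
in ε with the same constant term as the right, so only the coefficients of ε need comparing; that is
`h4`, a polynomial inequality in r. -/
theorem half_rate_poly {r ε : ℝ} (hr : 1 ≤ r) (hε : 0 < ε) (hε1 : ε < 1) :
    (4 * r + 2 + ε) ^ 2 * (4 * r + 2 + r * ε) * (4 * r + (ε + ε ^ 2) * (r - 1)) ≤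
      4 * r * (1 + ε) * (4 * r + 2) ^ 3 := by
  have e2 : ε ^ 2 ≤ ε := by nlinarith
  have hr0 : 0 < r := by linarith
  have hm : 0 ≤ r - 1 := by linarith
  set q := 4 * r + 2 with hq
  have hq0 : 0 < q := by linarith
  set a := r * q ^ 2 + (2 * q + 1) * (q + r) with ha
  have ha0 : 0 < a := by positivity
  have h1 : (q + ε) ^ 2 ≤ q ^ 2 + ε * (2 * q + 1) := by nlinarith
  have h2 : (q ^ 2 + ε * (2 * q + 1)) * (q + r * ε) ≤ q ^ 3 + ε * a := by
    have : ε ^ 2 * ((2 * q + 1) * r) ≤ ε * ((2 * q + 1) * r) := by gcongr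
    rw [ha]
    linarith
  have h3 : 4 * r + (ε + ε ^ 2) * (r - 1) ≤ 4 * r + ε * (2 * (r - 1)) := by nlinarith
  have h4 : 4 * r * a + 2 * (r - 1) * (q ^ 3 + a) ≤ 4 * r * q ^ 3 := by
    rw [ha, hq]
    have := pow_pos hr0 2
    have := pow_pos hr0 3
    have := pow_pos hr0 4
    linarith
  calc (q + ε) ^ 2 * (q + r * ε) * (4 * r + (ε + ε ^ 2) * (r - 1))
      ≤ (q ^ 2 + ε * (2 * q + 1)) * (q + r * ε) * (4 * r + (ε + ε ^ 2) * (r - 1)) := by gcongr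
    _ ≤ (q ^ 3 + ε * a) * (4 * r + ε * (2 * (r - 1))) := by gcongr
    _ = 4 * r * q ^ 3 + ε * (4 * r * a + 2 * (r - 1) * q ^ 3) + ε ^ 2 * (2 * (r - 1) * a) := by
        ring
    _ ≤ 4 * r * q ^ 3 + ε * (4 * r * a + 2 * (r - 1) * q ^ 3) + ε * (2 * (r - 1) * a) := by
        gcongr
    _ = 4 * r * q ^ 3 + ε * (4 * r * a + 2 * (r - 1) * (q ^ 3 + a)) := by ring
    _ ≤ 4 * r * q ^ 3 + ε * (4 * r * q ^ 3) := by gcongr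
    _ = 4 * r * (1 + ε) * q ^ 3 := by ring

theorem half_rate_bound {r k α ε : ℝ} (hr : 1 ≤ r) (hε : 0 < ε) (hε1 : ε < 1)
    (hα : α = 8 * r / ε) (hk : 32 * r ^ 2 / ε ^ 2 + 16 * r / ε ^ 2 ≤ k) :
    0 < k ∧ α * (1 + ε)⁻¹ ≤ 2 - 2 * r + k * (α * (((1 + α / k)⁻¹) ^ 2 / (k + α * r))) := by
  have hr0 : 0 < r := by linarith
  have hk0 : 0 < k := lt_of_lt_of_le (by positivity) hk
  have hα0 : 0 < α := by rw [hα]; positivity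
  refine ⟨hk0, ?_⟩
  have hq : 0 < 4 * r + 2 := by linarith
  have hv : α / k ≤ ε / (4 * r + 2) := by
    rw [div_le_div_iff₀ hk0 hq]
    rw [← add_div, div_le_iff₀ (by positivity)] at hk
    have : α * ε = 8 * r := by rw [hα]; field_simp
    have h2 : ε * (α * (4 * r + 2)) ≤ ε * (ε * k) := by nlinarith
    exact le_of_mul_le_mul_left h2 hε
  set v := α / k with hvdef
  have hv0 : 0 < v := by positivity
  set b := ε / (4 * r + 2) with hb
  have hb0 : 0 < b := by positivity
  have hbε : b * (4 * r + 2) = ε := by rw [hb]; field_simp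
  have e1 : k * (α * (((1 + v)⁻¹) ^ 2 / (k + α * r))) = α * ((1 + v) ^ 2 * (1 + v * r))⁻¹ := by
    have : α = v * k := by rw [hvdef]; field_simp
    rw [this]
    field_simp
  -- The initial cost is rewritten as a multiple of α so that α factors out of the whole estimate.
  have e2 : 2 - 2 * r = -(α * (ε / 4 * (1 - 1 / r))) := by
    rw [hα]; field_simp
    ring
  have h1 : ((1 + b) ^ 2 * (1 + b * r))⁻¹ ≤ ((1 + v) ^ 2 * (1 + v * r))⁻¹ := by
    gcongr
  have h2 : (1 + ε)⁻¹ + ε / 4 * (1 - 1 / r) ≤ ((1 + b) ^ 2 * (1 + b * r))⁻¹ := by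
    have hp := half_rate_poly hr hε hε1
    have hL : (1 + ε)⁻¹ + ε / 4 * (1 - 1 / r) =
        (4 * r + (ε + ε ^ 2) * (r - 1)) / (4 * r * (1 + ε)) := by
      field_simp
    have hR : ((1 + b) ^ 2 * (1 + b * r))⁻¹ =
        (4 * r + 2) ^ 3 / ((4 * r + 2 + ε) ^ 2 * (4 * r + 2 + r * ε)) := by
      rw [hb]
      field_simp
    rw [hL, hR, div_le_div_iff₀ (by positivity) (by positivity)]
    linarith
  rw [e1, e2]
  have := mul_le_mul_of_nonneg_left (h2.trans h1) hα0.le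
  linarith

end Approximation

end RidgeDesign

/-! ### The approximation theorem -/

theorem theorem4p6 {n d k : ℕ} (X : Matrix (Fin n) (Fin d) ℝ) (hk : d ≤ k)
    (lam : ℝ) (hlam : 0 < lam)
    (f : Matrix (Fin d) (Fin d) ℝ → ℝ) (hf : RidgeDesign.IsCriterion f)
    (w : RidgeDesign.Regularizer) (α ε : ℝ) (hα : 0 < α) (hε : 0 < ε) (hε1 : ε < 1)
    (hcond :
      (w = RidgeDesign.Regularizer.entropy ∧ α = 4 * Real.log d / ε ∧
        16 * (d : ℝ) * Real.log d / ε ^ 2 ≤ (k : ℝ)) ∨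
      (w = RidgeDesign.Regularizer.half ∧ α = 8 * Real.sqrt d / ε ∧
        32 * (d : ℝ) / ε ^ 2 + 16 * Real.sqrt d / ε ^ 2 ≤ (k : ℝ)))
    (idx : Fin k → Fin n) (hidx : RidgeDesign.IsOutput w f X lam α k idx) :
    f ((X.submatrix idx id).transpose * X.submatrix idx id +
        lam • (1 : Matrix (Fin d) (Fin d) ℝ)) ≤
      (1 + ε) * RidgeDesign.optValue f X lam k := by
  open RidgeDesign in
  obtain ⟨p, hp, A, hA⟩ := hidx
  have hS := cov_posDef X hlam hp.1.1
  have hy := sum_smul_vecMulVec_denoised X hS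
  have hCpos (hk0 : 0 < k) : ((lam / k) • (cov X lam p)⁻¹).PosSemidef :=
    hS.inv.posSemidef.smul (by positivity)
  have hyk (hk0 : 0 < k) : ∑ i, p i • Matrix.vecMulVec (denoised X (cov X lam p) i)
      (denoised X (cov X lam p) i) = 1 - (k : ℝ) • ((lam / k) • (cov X lam p)⁻¹) := by
    have hk' : (k : ℝ) ≠ 0 := by exact_mod_cast hk0.ne'
    rw [hy, smul_smul, mul_div_cancel₀ _ hk']
  have hshift (M : Matrix (Fin d) (Fin d) ℝ) :
      (α * lam / k) • M = α • ((lam / k) • M) := by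
    rw [smul_smul, mul_div_assoc]
  rcases hcond with ⟨rfl, hαε, hkε⟩ | ⟨rfl, hαε, hkε⟩
  -- Since log 0 = log 1 = 0, a positive learning rate excludes d = 0 and d = 1.
  · have hd : 2 ≤ d := by
      by_contra hd
      have : d = 0 ∨ d = 1 := by omega
      rcases this with rfl | rfl <;> simp [hαε] at hα
    have hd' : (2 : ℝ) ≤ d := by exact_mod_cast hd
    obtain ⟨hk0, -, hαk, hτ⟩ := entropy_rate_bound hd' hε hε1 hαε hkε
    have hk0 : 0 < k := by exact_mod_cast hk0
    refine criterion_le_of_sum_loss_posSemidef hk0 X hlam hf hε hp idx ?_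
    refine sum_loss_entropy hk0 (by omega) hα hαk hτ (hCpos hk0) hp.1.1 hp.1.2 (hyk hk0) idx A
      (fun t => (hA t).1) fun t j => ?_
    have h := (hA t).2 j
    rwa [shifted, hshift] at h
  · have hd : 0 < d := by
      rcases Nat.eq_zero_or_pos d with rfl | h
      · simp [hαε] at hα
      · exact h
    have hr : 1 ≤ √(d : ℝ) := Real.one_le_sqrt.2 (by exact_mod_cast hd)
    have hkε' : 32 * √(d : ℝ) ^ 2 / ε ^ 2 + 16 * √(d : ℝ) / ε ^ 2 ≤ (k : ℝ) := by
      rwa [Real.sq_sqrt (Nat.cast_nonneg d)]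
    obtain ⟨hk0, hτ⟩ := half_rate_bound hr hε hε1 hαε hkε'
    have hk0 : 0 < k := by exact_mod_cast hk0
    refine criterion_le_of_sum_loss_posSemidef hk0 X hlam hf hε hp idx ?_
    refine sum_loss_half hk0 hd hα hτ (hCpos hk0) hp.1.1 hp.1.2 (hyk hk0) idx A
      (fun t => (hA t).1) fun t j => ?_
    have h := (hA t).2 j
    rwa [shifted, hshift] at h
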